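/- Let $n \ge 0$, let $\mathcal S(n)$ be the space of real symmetric $n\times n$ matrices and let $\mathcal J^2 := \mathbb R\times\mathbb R^n\times\mathcal S(n)$ be the space of $2$-jets. A \emph{constant coefficient subequation} is a set $\mathcal F\subset\mathcal J^2$ with $\mathcal F\neq\emptyset$, $\mathcal F\neq\mathcal J^2$, such that for all $(r,p,A)\in\mathcal F$ - (P) $(r,p,A+P)\in\mathcal F$ for every positive definite $P\in\mathcal S(n)$; - (N) $(r+s,p,A)\in\mathcal F$ for every $s<0$; and such that - (T) $\mathcal F=\overline{\operatorname{int}\mathcal F}$. For an open set $X\subset\mathbb R^n$, let $\mathrm{USC}(X)$ be the set of upper semicontinuous functions $u: X\to[-\infty,+\infty)$. For a set $\mathcal F\subset\mathcal J^2$, let $\mathcal F(X)$ be the set of $\mathcal F$-subharmonic functions on $X$: those $u\in\mathrm{USC}(X)$ such that, for every $x\in X$ and every function $\varphi$ which is $C^2$ near $x$ and satisfies $u\le\varphi$ near $x$ and $u(x)=\varphi(x)$, one has $(\varphi(x),D\varphi(x),D^2\varphi(x))\in\mathcal F$. **Corollary (Subharmonic addition for constant coefficient subequations).** Let $\mathcal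 F,\mathcal G\subset\mathcal J^2$ be constant coefficient subequations and let $\mathcal H\subset\mathcal J^2$ be a closed set (for instance, a constant coefficient subequation). Then, for every open set $X\subset\mathbb R^n$, jet addition implies subharmonic addition; that is, $$\mathcal F+\mathcal G\subset\mathcal H \implies \mathcal F(X)+\mathcal G(X)\subset\mathcal H(X),$$ where $\mathcal F+\mathcal G=\{J+J' : J\in\mathcal F,\ J'\in\mathcal G\}$, and $\mathcal F(X)+\mathcal G(X)$ consists of the pointwise sums $u+v$ (equal to $-\infty$ wherever $u$ or $v$ is $-\infty$) with $u\in\mathcal F(X)$, $v\in\mathcal G(X)$. -/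

import Mathlib

open scoped Pointwise Topology

noncomputable section

namespace PotentialTheory

/-- The space `𝒮(n)` of real symmetric `n × n` matrices, with its usual topology. -/
abbrev SymMat (n : ℕ) : Type := selfAdjoint (Matrix (Fin n) (Fin n) ℝ)

/-- The space of `2`-jets `𝒥² = ℝ × ℝⁿ × 𝒮(n)`. -/
abbrev Jet2 (n : ℕ) : Type := ℝ × EuclideanSpace ℝ (Fin n) × SymMat n

/-- A constant coefficient subequation on `ℝⁿ`, identified with its (constant) fiber in `𝒥²`. -/
structure IsConstCoeffSubequation {n : ℕ} (F : Set (Jet2 n)) : Prop where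
  nonempty : F.Nonempty
  ne_univ : F ≠ Set.univ
  positivity : ∀ (r : ℝ) (p : EuclideanSpace ℝ (Fin n)) (A P : SymMat n),
    (r, p, A) ∈ F → (P : Matrix (Fin n) (Fin n) ℝ).PosDef → (r, p, A + P) ∈ F
  negativity : ∀ (r : ℝ) (p : EuclideanSpace ℝ (Fin n)) (A : SymMat n) (s : ℝ),
    (r, p, A) ∈ F → s < 0 → (r + s, p, A) ∈ F
  topological : F = closure (interior F)

/-- The matrix `(∂²φ/∂xᵢ∂xⱼ)(x)` of second partial derivatives. -/
def hessian {n : ℕ} (φ : EuclideanSpace ℝ (Fin n) → ℝ) (x : EuclideanSpace ℝ (Fin n)) :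
    Matrix (Fin n) (Fin n) ℝ :=
  Matrix.of fun i j => fderiv ℝ (fderiv ℝ φ) x (EuclideanSpace.single i 1)
    (EuclideanSpace.single j 1)

theorem hessian_mem_selfAdjoint {n : ℕ} {φ : EuclideanSpace ℝ (Fin n) → ℝ}
    {x : EuclideanSpace ℝ (Fin n)} (hφ : ContDiffAt ℝ 2 φ x) :
    hessian φ x ∈ selfAdjoint (Matrix (Fin n) (Fin n) ℝ) := by
  have h : IsSymmSndFDerivAt ℝ φ x := hφ.isSymmSndFDerivAt (by simp)
  rw [selfAdjoint.mem_iff]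
  ext i j
  simpa [hessian, Matrix.star_apply] using h.eq _ _

/-- The `2`-jet `J²ₓφ = (φ(x), Dφ(x), D²φ(x))` of a function which is `C²` near `x`. -/
def jet2 {n : ℕ} (φ : EuclideanSpace ℝ (Fin n) → ℝ) (x : EuclideanSpace ℝ (Fin n))
    (hφ : ContDiffAt ℝ 2 φ x) : Jet2 n :=
  (φ x, gradient φ x, ⟨hessian φ x, hessian_mem_selfAdjoint hφ⟩)

/-- `u ∈ USC(X)`: `u` is upper semicontinuous on `X` with values in `[-∞, +∞)`.
Only the values of `u` on `X` matter. -/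
def IsUSC {n : ℕ} (X : Set (EuclideanSpace ℝ (Fin n)))
    (u : EuclideanSpace ℝ (Fin n) → EReal) : Prop :=
  UpperSemicontinuousOn u X ∧ ∀ x ∈ X, u x ≠ ⊤

/-- `u` is `F`-subharmonic at `x`: the `2`-jet at `x` of every `C²` upper test function for `u`
at `x` lies in `F`. (If `u x = -∞` there are no test functions and the condition is void.) -/
def IsSubharmonicAt {n : ℕ} (F : Set (Jet2 n)) (u : EuclideanSpace ℝ (Fin n) → EReal)
    (x : EuclideanSpace ℝ (Fin n)) : Prop :=
  ∀ (φ : EuclideanSpace ℝ (Fin n) → ℝ) (hφ : ContDiffAt ℝ 2 φ x),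
    (∀ᶠ y in 𝓝 x, u y ≤ (φ y : EReal)) → u x = (φ x : EReal) → jet2 φ x hφ ∈ F

/-- The space `F(X)` of `F`-subharmonic functions on an open set `X`. -/
def subharmonics {n : ℕ} (F : Set (Jet2 n)) (X : Set (EuclideanSpace ℝ (Fin n))) :
    Set (EuclideanSpace ℝ (Fin n) → EReal) :=
  {u | IsUSC X u ∧ ∀ x ∈ X, IsSubharmonicAt F u x}

end PotentialTheory

end

/-!
A `C²` test function touching `u + v` from above at `x₀` gives a second order upper jet of `u + v`
there, and the point is to approximate it by sums of upper jets of `u` and of `v` taken separately,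
up to a small positive multiple of the identity in the Hessian. This is Jensen's and Ishii's theorem
on sums. Subtracting `T ‖x - y‖²` for large `T` turns the upper jet of `u + v` into one of
`(x, y) ↦ u x + v y` at a point near `(x₀, x₀)`. Now double the variables with the penalty `C ‖·‖²`
and replace `u` and `v` by `C^{1,1}` functions squeezed between their sup-convolutions and the
quadratics of opening `C` above these; a contact point `x` of the interpolant with the
sup-convolution parabola of a point `a` transports its second order expansion at `x` to an upper
jet at `a`. The derivatives of the interpolants being Lipschitz, Rademacher's theorem makes them
differentiable outside a null set, whose image is null: after a generic small linear perturbation,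
every maximum point is therefore a point of twice differentiability, where the second derivative
test bounds the Hessians. Adding a small multiple of the identity to each Hessian makes the jets
those of quadratic test functions, so the jet of the original test function is a limit of elements
of `F + G`. The value `-∞` is harmless because only points with `u a + v b` close to
`u x₀ + v x₀` enter, where `u` and `v` agree with their truncations from below.
-/

noncomputable section

open Set

namespace PotentialTheory

section ConvexAnalysis

section TopologicalVectorSpace

variable {E : Type*} [AddCommGroup E] [TopologicalSpace E] [IsTopologicalAddGroup E] [Module ℝ E]
  [ContinuousSMul ℝ E] {f : E → ℝ}

theorem exists_subgradient (hf : ConvexOn ℝ univ f) (hcont : Continuous f) (x : E) :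
    ∃ p : E →L[ℝ] ℝ, ∀ y, f x + p (y - x) ≤ f y := by
  have hopen : IsOpen {q : E × ℝ | q.1 ∈ univ ∧ f q.1 < q.2} := by
    simpa using isOpen_lt (hcont.comp continuous_fst) continuous_snd
  obtain ⟨L, hL⟩ := geometric_hahn_banach_open_point (x := (x, f x)) hf.convex_strict_epigraph
    hopen (fun h => lt_irrefl _ h.2)
  have hsplit : ∀ y t, L (y, t) = L (y, 0) + t * L (0, 1) := fun y t => by
    rw [← smul_eq_mul, ← map_smul, ← map_add]
    simp
  have hsep : ∀ y t, f y < t → L (y, 0) + t * L (0, 1) < L (x, 0) + f x * L (0, 1) :=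
    fun y t ht => by simpa only [← hsplit] using hL (y, t) ⟨mem_univ y, ht⟩
  have hneg : L (0, 1) < 0 := by linarith [hsep x (f x + 1) (lt_add_one _)]
  have hweak : ∀ y, L (y, 0) + f y * L (0, 1) ≤ L (x, 0) + f x * L (0, 1) := fun y =>
    le_of_forall_pos_lt_add fun ε hε => by
      have h := hsep y (f y + ε / -L (0, 1)) (lt_add_of_pos_right _ (div_pos hε (neg_pos.2 hneg)))
      have hcancel : ε / -L (0, 1) * L (0, 1) = -ε := by
        rw [div_neg, neg_mul, div_mul_cancel₀ _ hneg.ne]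
      linarith
  refine ⟨(-(L (0, 1))⁻¹) • L.comp (ContinuousLinearMap.inl ℝ E ℝ), fun y => ?_⟩
  have hlin : L (y - x, 0) = L (y, 0) - L (x, 0) := by rw [← map_sub]; simp
  refine (mul_le_mul_right_of_neg hneg).1 ?_
  simp only [smul_apply, ContinuousLinearMap.comp_apply, ContinuousLinearMap.inl_apply, hlin,
    smul_eq_mul]
  linear_combination hweak y + (L (y, 0) - L (x, 0)) * mul_inv_cancel₀ hneg.ne

end TopologicalVectorSpace

section NormedSpace

variable {E : Type*} [NormedAddCommGroup E] [NormedSpace ℝ E] {f g : E → ℝ} {f' : E → E →L[ℝ] ℝ}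
  {K : ℝ}

theorem hasFDerivAt_of_abs_sub_le (hf : ∀ x y, |f y - f x - f' x (y - x)| ≤ K * ‖y - x‖ ^ 2)
    (x : E) : HasFDerivAt f (f' x) x := by
  rw [hasFDerivAt_iff_isLittleO]
  exact (Asymptotics.IsBigO.of_bound K <| .of_forall fun y => by simpa using hf x y).trans_isLittleO
    (Asymptotics.isLittleO_pow_sub_sub x one_lt_two)

theorem norm_sub_le_of_abs_sub_le (hf : ∀ x y, |f y - f x - f' x (y - x)| ≤ K * ‖y - x‖ ^ 2)
    (x y : E) : ‖f' x - f' y‖ ≤ 6 * K * ‖x - y‖ := by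
  rcases eq_or_ne x y with rfl | hxy
  · simp
  have hr : 0 < ‖x - y‖ := norm_pos_iff.2 (sub_ne_zero.2 hxy)
  have hK : 0 ≤ K := nonneg_of_mul_nonneg_left ((abs_nonneg _).trans (hf y x)) (by positivity)
  refine ((f' x - f' y).opNorm_bound_of_ball_bound hr (6 * K * ‖x - y‖ ^ 2)
    fun k hk => ?_).trans_eq (by field_simp)
  rw [mem_closedBall_zero_iff] at hk
  have hxk : ‖y + k - x‖ ≤ 2 * ‖x - y‖ := by
    calc ‖y + k - x‖ = ‖k - (x - y)‖ := by congr 1; abel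
      _ ≤ ‖k‖ + ‖x - y‖ := norm_sub_le _ _
      _ ≤ 2 * ‖x - y‖ := by linarith
  have far : |f (y + k) - f x - f' x (y - x) - f' x k| ≤ K * (2 * ‖x - y‖) ^ 2 := by
    have h := hf x (y + k)
    rw [add_sub_right_comm, map_add, ← sub_sub] at h
    exact h.trans (by rw [add_sub_right_comm] at hxk; gcongr)
  have mid : |f y - f x - f' x (y - x)| ≤ K * ‖x - y‖ ^ 2 := by
    simpa only [norm_sub_rev y x] using hf x y
  have near : |f (y + k) - f y - f' y k| ≤ K * ‖x - y‖ ^ 2 := by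
    have h := hf y (y + k)
    rw [add_sub_cancel_left] at h
    exact h.trans (by gcongr)
  rw [sub_apply, Real.norm_eq_abs]
  rw [abs_le] at far mid near ⊢
  constructor <;> linarith

theorem lipschitzWith_of_abs_sub_le (hf : ∀ x y, |f y - f x - f' x (y - x)| ≤ K * ‖y - x‖ ^ 2) :
    LipschitzWith (6 * K).toNNReal f' :=
  LipschitzWith.of_dist_le_mul fun x y => by
    rw [dist_eq_norm, dist_eq_norm]
    exact (norm_sub_le_of_abs_sub_le hf x y).trans (by gcongr; exact Real.le_coe_toNNReal _)

theorem eq_of_forall_le_add_norm_sq {p q : E →L[ℝ] ℝ} (h : ∀ k, q k ≤ p k + K * ‖k‖ ^ 2) :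
    q = p := by
  have hle : ∀ k, q k ≤ p k := fun k => by
    have hlim : Filter.Tendsto (fun t : ℝ => p k + t * (K * ‖k‖ ^ 2)) (𝓝[>] 0) (𝓝 (p k)) := by
      have : Continuous fun t : ℝ => p k + t * (K * ‖k‖ ^ 2) := by fun_prop
      simpa using (this.tendsto 0).mono_left nhdsWithin_le_nhds
    refine ge_of_tendsto hlim ?_
    filter_upwards [self_mem_nhdsWithin] with t (ht : 0 < t)
    have hscaled := h (t • k)
    simp only [map_smul, norm_smul, Real.norm_of_nonneg ht.le, smul_eq_mul] at hscaled
    refine le_of_mul_le_mul_left ?_ ht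
    linarith
  ext k
  exact (hle k).antisymm (by simpa using hle (-k))

/-- The affine functions `y ↦ c + p y` lying above `g`, encoded as pairs `(c, p)`. -/
def affineMajorants (g : E → ℝ) : Set (ℝ × (E →L[ℝ] ℝ)) :=
  {ℓ | ∀ y, g y ≤ ℓ.1 + ℓ.2 y}

/-- The concave envelope of `g`: the infimum of its affine majorants. It takes the junk value `0`
when `g` has none. -/
def concaveEnvelope (g : E → ℝ) (x : E) : ℝ :=
  ⨅ ℓ : affineMajorants g, ((ℓ : ℝ × (E →L[ℝ] ℝ)).1 + (ℓ : ℝ × (E →L[ℝ] ℝ)).2 x)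

theorem concaveEnvelope_le {ℓ : ℝ × (E →L[ℝ] ℝ)} (hℓ : ℓ ∈ affineMajorants g) (x : E) :
    concaveEnvelope g x ≤ ℓ.1 + ℓ.2 x :=
  ciInf_le (f := fun ℓ : affineMajorants g => ℓ.1.1 + ℓ.1.2 x)
    ⟨g x, by rintro _ ⟨ℓ, rfl⟩; exact ℓ.2 x⟩ ⟨ℓ, hℓ⟩

theorem le_concaveEnvelope_of_forall (hg : (affineMajorants g).Nonempty) {x : E} {c : ℝ}
    (h : ∀ ℓ ∈ affineMajorants g, c ≤ ℓ.1 + ℓ.2 x) : c ≤ concaveEnvelope g x :=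
  have := hg.to_subtype
  le_ciInf fun ℓ => h ℓ ℓ.2

theorem le_concaveEnvelope (hg : (affineMajorants g).Nonempty) (x : E) :
    g x ≤ concaveEnvelope g x :=
  le_concaveEnvelope_of_forall hg fun _ hℓ => hℓ x

theorem exists_affineMajorant_lt (hg : (affineMajorants g).Nonempty) (x : E) {c : ℝ}
    (hc : concaveEnvelope g x < c) : ∃ ℓ ∈ affineMajorants g, ℓ.1 + ℓ.2 x < c := by
  by_contra! h
  exact hc.not_ge (le_concaveEnvelope_of_forall hg h)

theorem concaveOn_concaveEnvelope (hg : (affineMajorants g).Nonempty) :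
    ConcaveOn ℝ univ (concaveEnvelope g) := by
  refine ⟨convex_univ, fun x _ y _ s t hs ht hst => le_concaveEnvelope_of_forall hg fun ℓ hℓ => ?_⟩
  calc s • concaveEnvelope g x + t • concaveEnvelope g y
      ≤ s • (ℓ.1 + ℓ.2 x) + t • (ℓ.1 + ℓ.2 y) := by
        gcongr <;> exact concaveEnvelope_le hℓ _
    _ = (s + t) * ℓ.1 + ℓ.2 (s • x + t • y) := by
        simp only [map_add, map_smul, smul_eq_mul]; ring
    _ = ℓ.1 + ℓ.2 (s • x + t • y) := by rw [hst, one_mul]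

/-- Affine majorants `α`, `β` near `x`, `y` are interpolated by the affine majorant
`z ↦ s α (z + t (x - y)) + t β (z - s (x - y)) - s t φ ‖x - y‖`. -/
theorem uniformConvexOn_concaveEnvelope {φ : ℝ → ℝ} (hg : (affineMajorants g).Nonempty)
    (hconv : UniformConvexOn univ φ g) : UniformConvexOn univ φ (concaveEnvelope g) := by
  refine ⟨convex_univ, fun x _ y _ s t hs ht hst => le_of_forall_pos_le_add fun ε hε => ?_⟩
  obtain ⟨α, hα, hαx⟩ := exists_affineMajorant_lt hg x (lt_add_of_pos_right _ hε)
  obtain ⟨β, hβ, hβy⟩ := exists_affineMajorant_lt hg y (lt_add_of_pos_right _ hε)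
  let γ : ℝ × (E →L[ℝ] ℝ) :=
    (s * (α.1 + t * α.2 (x - y)) + t * (β.1 - s * β.2 (x - y)) - s * t * φ ‖x - y‖,
      s • α.2 + t • β.2)
  have hγ : γ ∈ affineMajorants g := fun z => by
    have hz : s • (z + t • (x - y)) + t • (z - s • (x - y)) = z := by
      obtain rfl : t = 1 - s := by linarith
      module
    have hdiff : z + t • (x - y) - (z - s • (x - y)) = x - y := by
      obtain rfl : t = 1 - s := by linarith
      module
    have h := hconv.2 (mem_univ (z + t • (x - y))) (mem_univ (z - s • (x - y))) hs ht hst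
    rw [hz, hdiff] at h
    have hαz := mul_le_mul_of_nonneg_left (hα (z + t • (x - y))) hs
    have hβz := mul_le_mul_of_nonneg_left (hβ (z - s • (x - y))) ht
    simp only [map_add, map_sub, map_smul, smul_eq_mul] at h hαz hβz
    simp only [γ, add_apply, smul_apply, map_sub, smul_eq_mul]
    linarith
  have hxy : γ.1 + γ.2 (s • x + t • y) =
      s * (α.1 + α.2 x) + t * (β.1 + β.2 y) - s * t * φ ‖x - y‖ := by
    obtain rfl : t = 1 - s := by linarith
    simp only [γ, add_apply, smul_apply, map_sub, map_add, map_smul, smul_eq_mul]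
    ring
  refine (concaveEnvelope_le hγ _).trans ?_
  rw [hxy, smul_eq_mul, smul_eq_mul]
  linarith [mul_le_mul_of_nonneg_left hαx.le hs, mul_le_mul_of_nonneg_left hβy.le ht,
    congrArg (· * ε) hst]

end NormedSpace

end ConvexAnalysis

section SupConvolution

variable {E : Type*} [NormedAddCommGroup E] {u : E → ℝ} {B : Set E} {C : ℝ}

/-- The sup-convolution `x ↦ sup {u a - C ‖x - a‖² : a ∈ B}` of the restriction of `u` to `B`. -/
def supConv (B : Set E) (u : E → ℝ) (C : ℝ) (x : E) : ℝ :=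
  ⨆ a : B, (u a - C * ‖x - a‖ ^ 2)

theorem supConv_le (hB : B.Nonempty) {x : E} {c : ℝ} (h : ∀ a ∈ B, u a - C * ‖x - a‖ ^ 2 ≤ c) :
    supConv B u C x ≤ c :=
  have := hB.to_subtype
  ciSup_le fun a => h a a.2

theorem le_supConv (hC : 0 ≤ C) (hu : BddAbove (u '' B)) {a : E} (ha : a ∈ B) (x : E) :
    u a - C * ‖x - a‖ ^ 2 ≤ supConv B u C x := by
  obtain ⟨c, hc⟩ := hu
  refine le_ciSup (f := fun a : B => u a - C * ‖x - a‖ ^ 2) ⟨c, ?_⟩ ⟨a, ha⟩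
  rintro _ ⟨a, rfl⟩
  exact (sub_le_self _ (by positivity)).trans (hc (mem_image_of_mem u a.2))

end SupConvolution

/-- `f`, with derivative `f'`, is a `C^{1,1}` interpolant between the parabolas `u a - C ‖· - a‖²`,
`a ∈ B`, below it and all the parabolas of opening `C` above these. -/
structure IsInterpolant {E : Type*} [NormedAddCommGroup E] [NormedSpace ℝ E] (B : Set E)
    (u : E → ℝ) (C : ℝ) (f : E → ℝ) (f' : E → E →L[ℝ] ℝ) : Prop where
  abs_sub_le : ∀ x y, |f y - f x - f' x (y - x)| ≤ C * ‖y - x‖ ^ 2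
  le : ∀ a ∈ B, ∀ x, u a - C * ‖x - a‖ ^ 2 ≤ f x
  le_of_touching : ∀ (x₀ : E) (c : ℝ) (ℓ : E →L[ℝ] ℝ),
    (∀ y, ∀ a ∈ B, u a - C * ‖y - a‖ ^ 2 ≤ c + ℓ (y - x₀) + C * ‖y - x₀‖ ^ 2) → f x₀ ≤ c

section InnerProductSpace

variable {E : Type*} [NormedAddCommGroup E] [InnerProductSpace ℝ E] {u : E → ℝ} {B : Set E}
  {C : ℝ}

theorem norm_sq_eq_add_inner_sub (x y : E) :
    ‖y‖ ^ 2 = ‖x‖ ^ 2 + 2 * inner ℝ x (y - x) + ‖y - x‖ ^ 2 := by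
  rw [← norm_add_sq_real, add_sub_cancel]

theorem strongConvexOn_const_sub_norm_sq (c : ℝ) (a : E) :
    StrongConvexOn univ (-(2 * C)) fun x => c - C * ‖x - a‖ ^ 2 := by
  refine ⟨convex_univ, fun x _ y _ s t _ _ hst => le_of_eq ?_⟩
  obtain rfl : t = 1 - s := by linarith
  have hxa : s • x + (1 - s) • y - a = s • (x - a) + (1 - s) • (y - a) := by module
  have hxy : x - y = (x - a) - (y - a) := by abel
  simp only [hxa, hxy, norm_add_sq_real, norm_sub_sq_real, norm_smul, mul_pow, sq_abs,
    Real.norm_eq_abs, real_inner_smul_left, real_inner_smul_right, smul_eq_mul]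
  ring

theorem strongConvexOn_supConv (hB : B.Nonempty) (hC : 0 ≤ C) (hu : BddAbove (u '' B)) :
    StrongConvexOn univ (-(2 * C)) (supConv B u C) := by
  refine ⟨convex_univ, fun x hx y hy s t hs ht hst => supConv_le hB fun a ha => ?_⟩
  refine ((strongConvexOn_const_sub_norm_sq (u a) a).2 hx hy hs ht hst).trans ?_
  gcongr <;> exact le_supConv hC hu ha _

theorem exists_forall_abs_sub_le_of_concaveOn_of_strongConvexOn [FiniteDimensional ℝ E]
    {h : E → ℝ} {K : ℝ} (hconc : ConcaveOn ℝ univ h) (hconv : StrongConvexOn univ (-(2 * K)) h) :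
    ∃ h' : E → E →L[ℝ] ℝ, ∀ x y, h y ≤ h x + h' x (y - x) ∧
      h x + h' x (y - x) - K * ‖y - x‖ ^ 2 ≤ h y := by
  have continuous_of_convexOn : ∀ {f : E → ℝ}, ConvexOn ℝ univ f → Continuous f := fun hf =>
    continuousOn_univ.1 (hf.continuousOn isOpen_univ)
  have hconv' := strongConvexOn_iff_convex.1 hconv
  choose p hp using exists_subgradient hconc.neg (continuous_of_convexOn hconc.neg)
  choose q hq using exists_subgradient hconv' (continuous_of_convexOn hconv')
  refine ⟨fun x => -p x, fun x y => ?_⟩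
  have above : ∀ y, h y ≤ h x + (-p x) (y - x) := fun y => by
    have := hp x y
    simp only [Pi.neg_apply, neg_apply] at this ⊢
    linarith
  have below : ∀ y, h x + (q x - (2 * K) • innerSL ℝ x) (y - x) - K * ‖y - x‖ ^ 2 ≤ h y :=
    fun y => by
      have := hq x y
      rw [norm_sq_eq_add_inner_sub x y] at this
      simp only [sub_apply, smul_apply, innerSL_apply_apply, smul_eq_mul]
      linarith
  have hpq : q x - (2 * K) • innerSL ℝ x = -p x := eq_of_forall_le_add_norm_sq fun k => by
    have h₁ := above (x + k)
    have h₂ := below (x + k)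
    rw [add_sub_cancel_left] at h₁ h₂
    linarith
  exact ⟨above y, by simpa only [hpq] using below y⟩

/-- The interpolant is `C ‖·‖²` plus the concave envelope of `w - C ‖·‖²`: the envelope inherits the
semiconvexity of `w`, and a quadratic of opening `C` above `w` becomes an affine majorant. -/
theorem exists_interpolant_of_strongConvexOn [FiniteDimensional ℝ E] {w : E → ℝ} (hC : 0 ≤ C)
    (hw : StrongConvexOn univ (-(2 * C)) w) (hbdd : BddAbove (range w)) :
    ∃ (f : E → ℝ) (f' : E → E →L[ℝ] ℝ), (∀ x y, |f y - f x - f' x (y - x)| ≤ C * ‖y - x‖ ^ 2) ∧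
      (∀ x, w x ≤ f x) ∧
      ∀ (x₀ : E) (c : ℝ) (ℓ : E →L[ℝ] ℝ),
        (∀ y, w y ≤ c + ℓ (y - x₀) + C * ‖y - x₀‖ ^ 2) → f x₀ ≤ c := by
  set g : E → ℝ := fun x => w x - C * ‖x‖ ^ 2 with hg
  have hne : (affineMajorants g).Nonempty := by
    obtain ⟨c, hc⟩ := hbdd
    exact ⟨(c, 0), fun y => by simpa [hg] using
      (hc (mem_range_self y)).trans (le_add_of_nonneg_right (by positivity))⟩
  have hgconv : StrongConvexOn univ (-(2 * (2 * C))) g := by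
    rw [strongConvexOn_iff_convex] at hw ⊢
    exact hw.congr fun x _ => by simp only [hg]; ring
  obtain ⟨h', hh'⟩ := exists_forall_abs_sub_le_of_concaveOn_of_strongConvexOn
    (concaveOn_concaveEnvelope hne) (uniformConvexOn_concaveEnvelope hne hgconv)
  refine ⟨fun x => concaveEnvelope g x + C * ‖x‖ ^ 2, fun x => h' x + (2 * C) • innerSL ℝ x,
    fun x y => ?_, fun x => sub_le_iff_le_add.1 (le_concaveEnvelope hne x), fun x₀ c ℓ h => ?_⟩
  · obtain ⟨habove, hbelow⟩ := hh' x y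
    simp only [add_apply, smul_apply, innerSL_apply_apply, smul_eq_mul,
      norm_sq_eq_add_inner_sub x y]
    rw [abs_le]
    constructor <;> linarith
  · have hmaj : (c - ℓ x₀ + C * ‖x₀‖ ^ 2, ℓ - (2 * C) • innerSL ℝ x₀) ∈ affineMajorants g :=
      fun y => by
        have hy := h y
        simp only [norm_sub_sq_real, real_inner_comm, map_sub] at hy
        simp only [hg, sub_apply, smul_apply, innerSL_apply_apply, smul_eq_mul]
        linarith
    have := concaveEnvelope_le hmaj x₀
    simp only [sub_apply, smul_apply, innerSL_apply_apply, real_inner_self_eq_norm_sq,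
      smul_eq_mul] at this
    linarith

theorem exists_isInterpolant [FiniteDimensional ℝ E] (hC : 0 ≤ C) (hB : B.Nonempty)
    (hu : BddAbove (u '' B)) : ∃ f f', IsInterpolant B u C f f' := by
  have hbdd : BddAbove (range (supConv B u C)) := by
    obtain ⟨c, hc⟩ := hu
    refine ⟨c, ?_⟩
    rintro _ ⟨x, rfl⟩
    exact supConv_le hB fun a ha =>
      (sub_le_self _ (by positivity)).trans (hc (mem_image_of_mem u ha))
  obtain ⟨f, f', hf, hle, htouch⟩ :=
    exists_interpolant_of_strongConvexOn hC (strongConvexOn_supConv hB hC hu) hbdd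
  exact ⟨f, f', hf, fun a ha x => (le_supConv hC hu ha x).trans (hle x),
    fun x₀ c ℓ h => htouch x₀ c ℓ fun y => supConv_le hB (h y)⟩

end InnerProductSpace

section RegularValues

open MeasureTheory

theorem exists_forall_eq_imp_differentiableAt {V W : Type*} [NormedAddCommGroup V]
    [NormedSpace ℝ V] [FiniteDimensional ℝ V] [NormedAddCommGroup W] [NormedSpace ℝ W]
    [FiniteDimensional ℝ W] (hdim : Module.finrank ℝ V = Module.finrank ℝ W) {K : NNReal}
    {Θ : V → W} (hΘ : LipschitzWith K Θ) {δ : ℝ} (hδ : 0 < δ) :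
    ∃ p ∈ Metric.ball (0 : W) δ, ∀ x, Θ x = p → DifferentiableAt ℝ Θ x := by
  borelize V W
  set S : Set V := {x | ¬ DifferentiableAt ℝ Θ x}
  have hS : μH[Module.finrank ℝ V] S = 0 := hΘ.ae_differentiableAt (μ := μH[Module.finrank ℝ V])
  have hΘS : μH[Module.finrank ℝ W] (Θ '' S) = 0 := by
    have h := hΘ.hausdorffMeasure_image_le (Nat.cast_nonneg (Module.finrank ℝ V)) S
    rw [hS, mul_zero, hdim] at h
    exact nonpos_iff_eq_zero.1 h
  have hball : 0 < μH[Module.finrank ℝ W] (Metric.ball (0 : W) δ) := Metric.measure_ball_pos _ 0 hδ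
  obtain ⟨p, hp, hpS⟩ : ∃ p ∈ Metric.ball (0 : W) δ, p ∉ Θ '' S :=
    not_subset.1 fun h => hball.ne' (measure_mono_null h hΘS)
  exact ⟨p, hp, fun x hx => not_not.1 fun hdiff => hpS ⟨x, hdiff, hx⟩⟩

theorem frequently_isLocalMax_sub_imp_differentiableAt {V : Type*} [NormedAddCommGroup V]
    [NormedSpace ℝ V] [FiniteDimensional ℝ V] {g : V → ℝ} {g' : V → V →L[ℝ] ℝ} {K : NNReal}
    (hg : ∀ x, HasFDerivAt g (g' x) x) (hg' : LipschitzWith K g') :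
    ∃ᶠ p : V →L[ℝ] ℝ in 𝓝 0,
      ∀ x, IsLocalMax (fun y => g y - p y) x → DifferentiableAt ℝ g' x := by
  have hdim : Module.finrank ℝ V = Module.finrank ℝ (V →L[ℝ] ℝ) := by
    rw [← (LinearMap.toContinuousLinearMap (𝕜 := ℝ) (E := V) (F' := ℝ)).finrank_eq]
    exact (Subspace.dual_finrank_eq (K := ℝ) (V := V)).symm
  refine Metric.nhds_basis_ball.frequently_iff.2 fun δ hδ => ?_
  obtain ⟨p, hp, hdiff⟩ := exists_forall_eq_imp_differentiableAt hdim hg' hδ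
  exact ⟨p, hp, fun x hx => hdiff x <| sub_eq_zero.1 <|
    hx.hasFDerivAt_eq_zero ((hg x).sub p.hasFDerivAt)⟩

end RegularValues

section SecondOrder

variable {E : Type*} [NormedAddCommGroup E] [NormedSpace ℝ E] {p q : E →L[ℝ] ℝ}
  {A : E →L[ℝ] E →L[ℝ] ℝ} {f u : E → ℝ} {f' : E → E →L[ℝ] ℝ} {x a : E}

/-- The quadratic polynomial `h ↦ p h + ½ A h h` with zero constant term. -/
def quadPoly (p : E →L[ℝ] ℝ) (A : E →L[ℝ] E →L[ℝ] ℝ) (h : E) : ℝ :=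
  p h + A h h / 2

/-- The symmetric part of a bilinear form. -/
def symmPart (A : E →L[ℝ] E →L[ℝ] ℝ) : E →L[ℝ] E →L[ℝ] ℝ :=
  (1 / 2 : ℝ) • (A + A.flip)

theorem symmPart_apply (A : E →L[ℝ] E →L[ℝ] ℝ) (h k : E) :
    symmPart A h k = (A h k + A k h) / 2 := by
  simp only [symmPart, add_apply, smul_apply, ContinuousLinearMap.flip_apply, smul_eq_mul]
  ring

theorem quadPoly_zero : quadPoly p A 0 = 0 := by
  simp [quadPoly]

theorem quadPoly_add (x h : E) :
    quadPoly p A (x + h) = quadPoly p A x + quadPoly (p + symmPart A x) A h := by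
  simp only [quadPoly, map_add, add_apply, symmPart_apply]
  ring

theorem hasFDerivAt_quadPoly (p : E →L[ℝ] ℝ) (A : E →L[ℝ] E →L[ℝ] ℝ) (x : E) :
    HasFDerivAt (quadPoly p A) (p + symmPart A x) x := by
  have hA := (A.hasFDerivAt (x := x)).clm_apply (hasFDerivAt_id x)
  refine (p.hasFDerivAt.add (hA.mul_const (1 / 2))).congr_of_eventuallyEq ?_ |>.congr_fderiv ?_
  · exact .of_forall fun y => by simp [quadPoly, div_eq_mul_inv]
  · ext h
    simp [symmPart_apply]
    ring

theorem contDiff_quadPoly {n : WithTop ℕ∞} : ContDiff ℝ n (quadPoly p A) := by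
  unfold quadPoly
  fun_prop

theorem isLittleO_sub_quadPoly (hf : ∀ᶠ y in 𝓝 x, HasFDerivAt f (f' y) y)
    (hf' : HasFDerivAt f' A x) :
    (fun h => f (x + h) - f x - quadPoly (f' x) A h) =o[𝓝 0] fun h => ‖h‖ ^ 2 := by
  have hsymm : symmPart A = A := by
    ext h k
    rw [symmPart_apply, second_derivative_symmetric_of_eventually hf hf' k h, add_self_div_two]
  have hshift : Filter.Tendsto (fun h => x + h) (𝓝 0) (𝓝 x) :=
    (map_add_left_nhds_zero x).le
  obtain ⟨r, hr, hball⟩ := Metric.eventually_nhds_iff_ball.1 (hshift.eventually hf)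
  have hderiv : ∀ h ∈ Metric.ball (0 : E) r, HasFDerivWithinAt
      (fun h => f (x + h) - quadPoly (f' x) A h) (f' (x + h) - f' x - A h) (Metric.ball 0 r) h :=
    fun h hh => by
      have hd := ((hasFDerivAt_comp_add_left x).2 (hball h hh)).sub
        (hasFDerivAt_quadPoly (f' x) A h)
      rw [hsymm, ← sub_sub] at hd
      exact hd.hasFDerivWithinAt
  have hsmall : (fun h => f' (x + h) - f' x - A h) =o[𝓝[Metric.ball 0 r] 0]
      fun h : E => ‖h - 0‖ ^ 1 := by
    simpa using (hasFDerivAt_iff_isLittleO_nhds_zero.1 hf').norm_right.mono nhdsWithin_le_nhds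
  have h := (convex_ball (0 : E) r).isLittleO_pow_succ (Metric.mem_ball_self hr) hderiv hsmall
  rw [nhdsWithin_eq_nhds.2 (Metric.ball_mem_nhds 0 hr)] at h
  simpa [quadPoly_zero, sub_right_comm] using h

theorem apply_self_nonpos_of_isLocalMax (hf : ∀ᶠ y in 𝓝 x, HasFDerivAt f (f' y) y)
    (hf' : HasFDerivAt f' A x) (hmax : IsLocalMax f x) (h : E) : A h h ≤ 0 := by
  by_contra! hpos
  have hzero : f' x = 0 := hmax.hasFDerivAt_eq_zero hf.self_of_nhds
  have hh : 0 < ‖h‖ := norm_pos_iff.2 fun h0 => hpos.ne' (by simp [h0])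
  have hline : Filter.Tendsto (fun t : ℝ => t • h) (𝓝[>] 0) (𝓝 0) :=
    (Continuous.tendsto' (f := fun t : ℝ => t • h) (by fun_prop) 0 0 (zero_smul ℝ h)).mono_left
      nhdsWithin_le_nhds
  have hshift : Filter.Tendsto (fun k => x + k) (𝓝 0) (𝓝 x) :=
    (map_add_left_nhds_zero x).le
  have htaylor := (isLittleO_sub_quadPoly hf hf').def
    (show 0 < A h h / (4 * ‖h‖ ^ 2) by positivity)
  obtain ⟨t, ht, htay, hle⟩ := (eventually_mem_nhdsWithin.and
    (hline.eventually (htaylor.and (hshift.eventually hmax)))).exists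
  have ht : 0 < t := ht
  have hbound : A h h / (4 * ‖h‖ ^ 2) * (t ^ 2 * ‖h‖ ^ 2) = t ^ 2 * A h h / 4 := by field_simp
  simp only [hzero, quadPoly, zero_apply, map_smul, smul_apply, smul_eq_mul, norm_smul,
    Real.norm_eq_abs, mul_pow, sq_abs, abs_mul, abs_pow, abs_norm, hbound] at htay
  nlinarith [(abs_le.1 htay).1, mul_pos (pow_pos ht 2) hpos]

/-- `(p, A)` is a second order upper jet of `u` at `a`, in the sense of Peano. -/
def HasUpperJet (u : E → ℝ) (a : E) (p : E →L[ℝ] ℝ) (A : E →L[ℝ] E →L[ℝ] ℝ) : Prop :=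
  ∀ ε > 0, ∀ᶠ h in 𝓝 0, u (a + h) ≤ u a + quadPoly p A h + ε * ‖h‖ ^ 2

theorem hasUpperJet_of_hasFDerivAt (hf : ∀ᶠ y in 𝓝 x, HasFDerivAt f (f' y) y)
    (hf' : HasFDerivAt f' A x) (hle : ∀ᶠ h in 𝓝 0, u (a + h) - u a ≤ f (x + h) - f x) :
    HasUpperJet u a (f' x) A := fun ε hε => by
  filter_upwards [(isLittleO_sub_quadPoly hf hf').def hε, hle] with h htay hh
  rw [norm_pow, norm_norm, Real.norm_eq_abs] at htay
  linarith [(abs_le.1 htay).2]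

theorem hasUpperJet_of_isLocalMax_sub_quadPoly
    (h : IsLocalMax (fun y => u y - quadPoly p A (y - x)) a) :
    HasUpperJet u a (p + symmPart A (a - x)) A := fun ε hε => by
  have hshift : Filter.Tendsto (fun k => a + k) (𝓝 0) (𝓝 a) :=
    (map_add_left_nhds_zero a).le
  filter_upwards [hshift.eventually h] with k hk
  rw [add_sub_right_comm, quadPoly_add] at hk
  linarith [show 0 ≤ ε * ‖k‖ ^ 2 by positivity]

theorem hasUpperJet_sub_comp_add_iff :
    HasUpperJet (fun h => u (x + h) - q h) a p A ↔ HasUpperJet u (x + a) (p + q) A := by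
  refine forall₂_congr fun ε _ => Filter.eventually_congr (.of_forall fun h => ?_)
  simp only [quadPoly, map_add, add_apply, add_assoc]
  constructor <;> intro <;> linarith

end SecondOrder

namespace IsInterpolant

variable {E : Type*} [NormedAddCommGroup E] [NormedSpace ℝ E] {B : Set E} {u f : E → ℝ} {C : ℝ}
  {f' : E → E →L[ℝ] ℝ}

theorem hasFDerivAt (h : IsInterpolant B u C f f') (x : E) : HasFDerivAt f (f' x) x :=
  hasFDerivAt_of_abs_sub_le h.abs_sub_le x

theorem lipschitzWith (h : IsInterpolant B u C f f') : LipschitzWith (6 * C).toNNReal f' :=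
  lipschitzWith_of_abs_sub_le h.abs_sub_le

theorem hasUpperJet (h : IsInterpolant B u C f f') {a x : E} {A : E →L[ℝ] E →L[ℝ] ℝ}
    (ha : B ∈ 𝓝 a) (hA : HasFDerivAt f' A x) (hx : f x = u a - C * ‖x - a‖ ^ 2) :
    HasUpperJet u a (f' x) A := by
  refine hasUpperJet_of_hasFDerivAt (.of_forall h.hasFDerivAt) hA ?_
  have hshift : Filter.Tendsto (fun k => a + k) (𝓝 0) (𝓝 a) :=
    (map_add_left_nhds_zero a).le
  filter_upwards [hshift ha] with k hk
  have := h.le (a + k) hk (x + k)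
  rw [add_sub_add_right_eq_sub] at this
  linarith

end IsInterpolant

section DoublingOfVariables

variable {V : Type*} [NormedAddCommGroup V] [NormedSpace ℝ V] {W N : V → ℝ} {K : Set V}
  {p : V →L[ℝ] ℝ} {M : V →L[ℝ] V →L[ℝ] ℝ} {ε : ℝ}

theorem exists_quadratic_sub_le (M : V →L[ℝ] V →L[ℝ] ℝ) (hε : 0 < ε) :
    ∃ c, 0 ≤ c ∧ ∀ a x : V,
      M a a / 2 - ε * ‖a‖ ^ 2 ≤ M x x / 2 - ε / 4 * ‖x‖ ^ 2 + c * ‖x - a‖ ^ 2 := by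
  refine ⟨‖M‖ ^ 2 / ε + ‖M‖ / 2 + ε, by positivity, fun a x => ?_⟩
  obtain ⟨d, rfl⟩ : ∃ d, a = x - d := ⟨x - a, by abel⟩
  have hxd := (abs_le.1 (M.le_opNorm₂ x d)).1
  have hdx := (abs_le.1 (M.le_opNorm₂ d x)).1
  have hdd := (abs_le.1 (M.le_opNorm₂ d d)).2
  have hnorm : ‖x‖ ^ 2 ≤ 2 * ‖x - d‖ ^ 2 + 2 * ‖d‖ ^ 2 := by
    have := norm_le_norm_sub_add x d
    nlinarith [norm_nonneg x, sq_nonneg (‖x - d‖ - ‖d‖)]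
  have hyoung : ‖M‖ * ‖x‖ * ‖d‖ ≤ ε / 4 * ‖x‖ ^ 2 + ‖M‖ ^ 2 / ε * ‖d‖ ^ 2 := by
    have : 0 ≤ (ε / 2 * ‖x‖ - ‖M‖ * ‖d‖) ^ 2 / ε := by positivity
    field_simp at this ⊢
    linarith
  simp only [map_sub, sub_apply, sub_sub_cancel]
  nlinarith

/-- The functional `(a, x) ↦ W a - N (x - a) - (p x + ½ M x x)`, in which the variable of `W` is
doubled at the price of the penalty `N`. -/
def doubledFunctional (W N : V → ℝ) (p : V →L[ℝ] ℝ) (M : V →L[ℝ] V →L[ℝ] ℝ) (z : V × V) : ℝ :=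
  W z.1 - N (z.2 - z.1) - quadPoly p M z.2

/-- The quadratic form of `M` strictly dominates, around `0`, the doubling of `W` with penalty
`N`. -/
def StrictlyDominates (K : Set V) (W N : V → ℝ) (M : V →L[ℝ] V →L[ℝ] ℝ) (ε : ℝ) : Prop :=
  ∀ a ∈ K, ∀ x, W a - N (x - a) ≤ W 0 + M x x / 2 - ε * ‖x‖ ^ 2 - ‖x - a‖ ^ 2

theorem exists_strictlyDominates (hε : 0 < ε)
    (hW : ∀ a ∈ K, W a ≤ W 0 + M a a / 2 - ε * ‖a‖ ^ 2) :
    ∃ c, 0 ≤ c ∧ ∀ N : V → ℝ, (∀ d, c * ‖d‖ ^ 2 ≤ N d) → StrictlyDominates K W N M (ε / 4) := by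
  obtain ⟨c, hc, hle⟩ := exists_quadratic_sub_le M hε
  refine ⟨c + 1, by positivity, fun N hN a ha x => ?_⟩
  linarith [hW a ha, hle a x, hN (x - a)]

theorem StrictlyDominates.add_norm_sq_le (h : StrictlyDominates K W N M ε) {a x : V} (ha : a ∈ K)
    (hax : W 0 ≤ doubledFunctional W N p M (a, x)) :
    ε * ‖x‖ ^ 2 + ‖x - a‖ ^ 2 ≤ ‖p‖ * ‖x‖ := by
  have hp := (abs_le.1 (p.le_opNorm x)).1
  have := h a ha x
  simp only [doubledFunctional, quadPoly] at hax
  linarith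

theorem StrictlyDominates.norm_le (h : StrictlyDominates K W N M ε) (hε : 0 < ε) {a x : V}
    (ha : a ∈ K) (hax : W 0 ≤ doubledFunctional W N p M (a, x)) : ‖x‖ ≤ ‖p‖ / ε := by
  have hle := h.add_norm_sq_le ha hax
  rcases (norm_nonneg x).eq_or_lt with hx | hx
  · rw [← hx]
    positivity
  · rw [le_div_iff₀ hε]
    nlinarith [sq_nonneg ‖x - a‖]

theorem StrictlyDominates.exists_isMaxOn [ProperSpace V] (h : StrictlyDominates K W N M ε)
    (hε : 0 < ε) (hK : IsCompact K) (h0 : 0 ∈ K) (hW : UpperSemicontinuousOn W K)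
    (hN : Continuous N) (hN0 : N 0 = 0) :
    ∃ z ∈ K ×ˢ univ, IsMaxOn (doubledFunctional W N p M) (K ×ˢ univ) z := by
  have hzero : doubledFunctional W N p M (0, 0) = W 0 := by
    simp [doubledFunctional, hN0, quadPoly_zero]
  have h00 : (0, 0) ∈ K ×ˢ Metric.closedBall (0 : V) (‖p‖ / ε) :=
    ⟨h0, Metric.mem_closedBall_self (by positivity)⟩
  have husc : UpperSemicontinuousOn (doubledFunctional W N p M)
      (K ×ˢ Metric.closedBall (0 : V) (‖p‖ / ε)) := by
    have hcont : Continuous fun z : V × V => -N (z.2 - z.1) - quadPoly p M z.2 := by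
      unfold quadPoly
      fun_prop
    have hWfst : UpperSemicontinuousOn (fun z : V × V => W z.1)
        (K ×ˢ Metric.closedBall (0 : V) (‖p‖ / ε)) := hW.comp continuousOn_fst fun z hz => hz.1
    have hsplit : doubledFunctional W N p M =
        fun z => W z.1 + (-N (z.2 - z.1) - quadPoly p M z.2) := by
      funext z
      rw [doubledFunctional, add_sub, ← sub_eq_add_neg]
    exact hsplit ▸ hWfst.add (hcont.upperSemicontinuous.upperSemicontinuousOn _)
  obtain ⟨z, hz, hmax⟩ := husc.exists_isMaxOn ⟨_, h00⟩ (hK.prod (isCompact_closedBall 0 _))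
  refine ⟨z, ⟨hz.1, mem_univ _⟩, fun y hy => ?_⟩
  by_cases hy0 : W 0 ≤ doubledFunctional W N p M y
  · exact hmax ⟨hy.1, mem_closedBall_zero_iff.2 (h.norm_le hε hy.1 hy0)⟩
  · exact (not_le.1 hy0).le.trans (hzero.symm.trans_le (hmax h00))

theorem StrictlyDominates.eventually_localized (h : StrictlyDominates K W N M ε) (hε : 0 < ε)
    (hN : ∀ d, 0 ≤ N d) {η : ℝ} (hη : 0 < η) :
    ∀ᶠ p in 𝓝 0, ∀ a ∈ K, ∀ x, W 0 ≤ doubledFunctional W N p M (a, x) →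
      ‖a‖ < η ∧ ‖p + symmPart M x‖ < η ∧ W 0 - η < W a := by
  have hgrad : ∀ᶠ p : V →L[ℝ] ℝ in 𝓝 0, ‖p‖ + ‖symmPart M‖ * (‖p‖ / ε) < η :=
    (Continuous.tendsto' (by fun_prop) _ 0 (by simp)).eventually_lt_const hη
  have ha : ∀ᶠ p : V →L[ℝ] ℝ in 𝓝 0, ‖p‖ / ε + √(‖p‖ * (‖p‖ / ε)) < η :=
    (Continuous.tendsto' (by fun_prop) _ 0 (by simp)).eventually_lt_const hη
  have hW : ∀ᶠ p : V →L[ℝ] ℝ in 𝓝 0, ‖p‖ * (‖p‖ / ε) + ‖M‖ * (‖p‖ / ε) * (‖p‖ / ε) < η :=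
    (Continuous.tendsto' (by fun_prop) _ 0 (by simp)).eventually_lt_const hη
  filter_upwards [ha, hgrad, hW] with p hap hgradp hWp a haK x hax
  have hnorm := h.norm_le hε haK hax
  refine ⟨?_, ?_, ?_⟩
  · have hdist : ‖x - a‖ ≤ √(‖p‖ * (‖p‖ / ε)) := Real.le_sqrt_of_sq_le <| by
      have := h.add_norm_sq_le haK hax
      have : ‖p‖ * ‖x‖ ≤ ‖p‖ * (‖p‖ / ε) := by gcongr
      nlinarith [sq_nonneg ‖x‖]
    linarith [norm_le_norm_add_norm_sub x a]
  · refine (norm_add_le_of_le le_rfl ?_).trans_lt hgradp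
    exact (symmPart M).le_opNorm_of_le hnorm
  · have hp := (abs_le.1 (p.le_opNorm x)).1
    have hM := (abs_le.1 (M.le_opNorm₂ x x)).1
    have hp' : ‖p‖ * ‖x‖ ≤ ‖p‖ * (‖p‖ / ε) := by gcongr
    have hM' : ‖M‖ * ‖x‖ * ‖x‖ ≤ ‖M‖ * (‖p‖ / ε) * (‖p‖ / ε) := by gcongr
    have hMnonneg : 0 ≤ ‖M‖ * ‖x‖ * ‖x‖ := by positivity
    simp only [doubledFunctional, quadPoly] at hax
    linarith [hN (x - a)]

end DoublingOfVariables

section SeparatedSum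

/-- The function `(x, y) ↦ f x + g y` with separated variables. -/
def separatedSum {E F : Type*} (f : E → ℝ) (g : F → ℝ) (z : E × F) : ℝ :=
  f z.1 + g z.2

/-- The penalty `(x, y) ↦ C ‖x‖² + C ‖y‖²` for the doubling of both variables. -/
def separatedPenalty (E F : Type*) [NormedAddCommGroup E] [NormedAddCommGroup F] (C : ℝ) :
    E × F → ℝ :=
  separatedSum (fun x => C * ‖x‖ ^ 2) fun y => C * ‖y‖ ^ 2

theorem mul_norm_sq_le_separatedPenalty {E F : Type*} [NormedAddCommGroup E]
    [NormedAddCommGroup F] {C : ℝ} (hC : 0 ≤ C) (z : E × F) :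
    C * ‖z‖ ^ 2 ≤ separatedPenalty E F C z := by
  have h₁ : 0 ≤ C * ‖z.1‖ ^ 2 := by positivity
  have h₂ : 0 ≤ C * ‖z.2‖ ^ 2 := by positivity
  simp only [separatedPenalty, separatedSum]
  rcases max_choice ‖z.1‖ ‖z.2‖ with h | h <;> rw [Prod.norm_def, h] <;> linarith

theorem continuous_separatedPenalty {E F : Type*} [NormedAddCommGroup E] [NormedAddCommGroup F]
    {C : ℝ} : Continuous (separatedPenalty E F C) := by
  unfold separatedPenalty separatedSum
  fun_prop

theorem separatedPenalty_zero {E F : Type*} [NormedAddCommGroup E] [NormedAddCommGroup F]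
    {C : ℝ} : separatedPenalty E F C 0 = 0 := by
  simp [separatedPenalty, separatedSum]

theorem upperSemicontinuousOn_separatedSum {E F : Type*} [TopologicalSpace E]
    [TopologicalSpace F] {u : E → ℝ} {v : F → ℝ} {B : Set E} {D : Set F}
    (hu : UpperSemicontinuousOn u B)
    (hv : UpperSemicontinuousOn v D) : UpperSemicontinuousOn (separatedSum u v) (B ×ˢ D) :=
  (hu.comp continuousOn_fst fun _ hz => hz.1).add (hv.comp continuousOn_snd fun _ hz => hz.2)

variable {E F V : Type*} [NormedAddCommGroup E] [NormedSpace ℝ E] [NormedAddCommGroup F]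
  [NormedSpace ℝ F] [NormedAddCommGroup V] [NormedSpace ℝ V] {u f : E → ℝ} {v g : F → ℝ}
  {f' : E → E →L[ℝ] ℝ} {g' : F → F →L[ℝ] ℝ} {B : Set E} {D : Set F} {C : ℝ}

theorem hasFDerivAt_separatedSum {p : E →L[ℝ] ℝ} {q : F →L[ℝ] ℝ} {z : E × F}
    (hf : HasFDerivAt f p z.1) (hg : HasFDerivAt g q z.2) :
    HasFDerivAt (separatedSum f g) (p.coprod q) z :=
  (hf.comp z hasFDerivAt_fst).add (hg.comp z hasFDerivAt_snd)

theorem upperSemicontinuousOn_comp_add_sub {x : E} {ρ : ℝ}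
    (hu : UpperSemicontinuousOn u (Metric.closedBall x ρ)) (q : E →L[ℝ] ℝ) :
    UpperSemicontinuousOn (fun h => u (x + h) - q h) (Metric.closedBall 0 ρ) := by
  have hmaps : MapsTo (fun h => x + h) (Metric.closedBall 0 ρ) (Metric.closedBall x ρ) :=
    fun h hh => by simpa using hh
  have hq : Continuous fun h => -q h := by fun_prop
  have hsum := (hu.comp (by fun_prop) hmaps).add (hq.upperSemicontinuous.upperSemicontinuousOn _)
  exact hsum

theorem separatedSum_comp_add_sub (u : E → ℝ) (v : F → ℝ) (z₀ : E × F) (P : E × F →L[ℝ] ℝ) :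
    separatedSum (fun h => u (z₀.1 + h) - P.comp (.inl ℝ E F) h)
      (fun k => v (z₀.2 + k) - P.comp (.inr ℝ E F) k) =
      fun z => separatedSum u v (z₀ + z) - P z := by
  funext z
  rw [← P.comp_inl_add_comp_inr z]
  simp only [separatedSum, Prod.fst_add, Prod.snd_add]
  ring

theorem exists_lipschitzWith_coprod {K L : NNReal} (hf' : LipschitzWith K f')
    (hg' : LipschitzWith L g') :
    ∃ c, LipschitzWith c fun z : E × F => (f' z.1).coprod (g' z.2) := by
  have hfst : LipschitzWith _ fun z : E × F => (f' z.1).comp (.fst ℝ E F) :=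
    ((ContinuousLinearMap.compL ℝ (E × F) E ℝ).flip (.fst ℝ E F)).lipschitz.comp
      (hf'.comp LipschitzWith.prod_fst)
  have hsnd : LipschitzWith _ fun z : E × F => (g' z.2).comp (.snd ℝ E F) :=
    ((ContinuousLinearMap.compL ℝ (E × F) F ℝ).flip (.snd ℝ E F)).lipschitz.comp
      (hg'.comp LipschitzWith.prod_snd)
  have hsum := hfst.add hsnd
  exact ⟨_, hsum⟩

theorem exists_strictlyDominates_separatedPenalty {M : E × F →L[ℝ] E × F →L[ℝ] ℝ} {W : E × F → ℝ}
    {K : Set (E × F)} {ε : ℝ} (hε : 0 < ε)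
    (hW : ∀ z ∈ K, W z ≤ W 0 + M z z / 2 - ε * ‖z‖ ^ 2) :
    ∃ C, 0 ≤ C ∧ ‖M‖ ≤ 2 * C ∧ StrictlyDominates K W (separatedPenalty E F C) M (ε / 4) := by
  obtain ⟨c, hc, hdom⟩ := exists_strictlyDominates hε hW
  have hC : 0 ≤ max c (‖M‖ / 2) := hc.trans (le_max_left _ _)
  refine ⟨max c (‖M‖ / 2), hC, by linarith [le_max_right c (‖M‖ / 2)], hdom _ fun d => ?_⟩
  exact (mul_le_mul_of_nonneg_right (le_max_left c _) (sq_nonneg _)).trans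
    (mul_norm_sq_le_separatedPenalty hC d)

theorem differentiableAt_of_differentiableAt_coprod {z : E × F}
    (h : DifferentiableAt ℝ (fun z : E × F => (f' z.1).coprod (g' z.2)) z) :
    DifferentiableAt ℝ f' z.1 ∧ DifferentiableAt ℝ g' z.2 := by
  have hx : DifferentiableAt ℝ (fun x : E => (x, z.2)) z.1 := by fun_prop
  have hy : DifferentiableAt ℝ (fun y : F => (z.1, y)) z.2 := by fun_prop
  have hinl := ((ContinuousLinearMap.precomp ℝ (.inl ℝ E F)).differentiableAt).comp z.1
    (DifferentiableAt.comp (g := fun z : E × F => (f' z.1).coprod (g' z.2)) z.1 h hx)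
  have hinr := ((ContinuousLinearMap.precomp ℝ (.inr ℝ E F)).differentiableAt).comp z.2
    (DifferentiableAt.comp (g := fun z : E × F => (f' z.1).coprod (g' z.2)) z.2 h hy)
  constructor
  · simpa [Function.comp_def] using hinl
  · simpa [Function.comp_def] using hinr

theorem apply_add_apply_le_of_isLocalMax {p : E × F →L[ℝ] ℝ} {M : E × F →L[ℝ] E × F →L[ℝ] ℝ}
    {z : E × F} {A₁ : E →L[ℝ] E →L[ℝ] ℝ} {A₂ : F →L[ℝ] F →L[ℝ] ℝ}
    (hf : ∀ x, HasFDerivAt f (f' x) x) (hg : ∀ y, HasFDerivAt g (g' y) y)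
    (hA₁ : HasFDerivAt f' A₁ z.1) (hA₂ : HasFDerivAt g' A₂ z.2)
    (hmax : IsLocalMax (fun z => separatedSum f g z - quadPoly p M z) z) (h : E) (k : F) :
    A₁ h h + A₂ k k ≤ M (h, k) (h, k) := by
  have hfirst : ∀ y : E × F, HasFDerivAt (fun y => separatedSum f g y - quadPoly p M y)
      ((f' y.1).comp (.fst ℝ E F) + (g' y.2).comp (.snd ℝ E F) - (p + symmPart M y)) y := fun y =>
    (hasFDerivAt_separatedSum (hf y.1) (hg y.2)).sub (hasFDerivAt_quadPoly p M y)
  have hsecond := (((ContinuousLinearMap.precomp ℝ (.fst ℝ E F)).hasFDerivAt.comp z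
    (hA₁.comp z hasFDerivAt_fst)).add ((ContinuousLinearMap.precomp ℝ (.snd ℝ E F)).hasFDerivAt.comp
    z (hA₂.comp z hasFDerivAt_snd))).sub ((symmPart M).hasFDerivAt.const_add p)
  have := apply_self_nonpos_of_isLocalMax (.of_forall hfirst) hsecond hmax (h, k)
  simpa [symmPart_apply] using this

theorem IsInterpolant.le_of_le_quadPoly {p : V →L[ℝ] ℝ} {M : V →L[ℝ] V →L[ℝ] ℝ} {T : E →L[ℝ] V}
    {x₀ : E} {z : V} {c : ℝ} (hf : IsInterpolant B u C f f') (hM : ‖M‖ ≤ 2 * C) (hT : ‖T‖ ≤ 1)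
    (hle : ∀ x, ∀ a ∈ B, u a - C * ‖x - a‖ ^ 2 ≤ c + quadPoly p M (z + T (x - x₀))) :
    f x₀ ≤ c + quadPoly p M z := by
  refine hf.le_of_touching x₀ _ ((p + symmPart M z).comp T) fun x a ha => (hle x a ha).trans ?_
  have hT' : ‖T (x - x₀)‖ ≤ ‖x - x₀‖ := T.le_of_opNorm_le_of_le hT le_rfl |>.trans_eq (one_mul _)
  have hMT : M (T (x - x₀)) (T (x - x₀)) ≤ 2 * C * ‖x - x₀‖ * ‖x - x₀‖ :=
    (le_abs_self _).trans (M.le_of_opNorm₂_le_of_le hM hT' hT')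
  rw [quadPoly_add, ContinuousLinearMap.comp_apply, quadPoly.eq_1 (p + symmPart M z)]
  linarith

theorem IsInterpolant.separatedSum_le {p : E × F →L[ℝ] ℝ} {M : E × F →L[ℝ] E × F →L[ℝ] ℝ} {m : ℝ}
    (hf : IsInterpolant B u C f f') (hg : IsInterpolant D v C g g') (hM : ‖M‖ ≤ 2 * C)
    (hle : ∀ a ∈ B ×ˢ D, ∀ x,
      doubledFunctional (separatedSum u v) (separatedPenalty E F C) p M (a, x) ≤ m) (z : E × F) :
    separatedSum f g z ≤ m + quadPoly p M z := by
  simp only [doubledFunctional, separatedPenalty, separatedSum, Prod.fst_sub, Prod.snd_sub] at hle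
  have hfle : ∀ y, ∀ b ∈ D,
      f z.1 ≤ (m - v b + C * ‖y - b‖ ^ 2) + quadPoly p M (z.1, y) := fun y b hb =>
    hf.le_of_le_quadPoly hM (ContinuousLinearMap.norm_inl_le_one ℝ E F) fun x a ha => by
      have := hle (a, b) ⟨ha, hb⟩ (x, y)
      simp only [ContinuousLinearMap.inl_apply, Prod.mk_add_mk, add_sub_cancel, add_zero]
      linarith
  have hgle : g z.2 ≤ (m - f z.1) + quadPoly p M z :=
    hg.le_of_le_quadPoly hM (ContinuousLinearMap.norm_inr_le_one ℝ E F) fun y b hb => by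
      have := hfle y b hb
      have hz : z + ContinuousLinearMap.inr ℝ E F (y - z.2) = (z.1, y) := by ext <;> simp
      rw [hz]
      linarith
  rw [separatedSum]
  linarith

theorem IsInterpolant.exists_hasUpperJet {p : E × F →L[ℝ] ℝ} {M : E × F →L[ℝ] E × F →L[ℝ] ℝ}
    {a x : E × F} (hf : IsInterpolant B u C f f') (hg : IsInterpolant D v C g g')
    (hM : ‖M‖ ≤ 2 * C) (hB : B ∈ 𝓝 a.1) (hD : D ∈ 𝓝 a.2)
    (hmax : IsMaxOn (doubledFunctional (separatedSum u v) (separatedPenalty E F C) p M)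
      ((B ×ˢ D) ×ˢ univ) (a, x))
    (hdiff : IsLocalMax (fun z => separatedSum f g z - quadPoly p M z) x →
      DifferentiableAt ℝ (fun z : E × F => (f' z.1).coprod (g' z.2)) x) :
    ∃ A₁ A₂, HasUpperJet u a.1 (f' x.1) A₁ ∧ HasUpperJet v a.2 (g' x.2) A₂ ∧
      (f' x.1).coprod (g' x.2) = p + symmPart M x ∧
      ∀ h k, A₁ h h + A₂ k k ≤ M (h, k) (h, k) := by
  have hle := hf.separatedSum_le hg hM fun b hb y => hmax ⟨hb, mem_univ y⟩
  have hfx := hf.le a.1 (mem_of_mem_nhds hB) x.1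
  have hgx := hg.le a.2 (mem_of_mem_nhds hD) x.2
  simp only [doubledFunctional, separatedSum, separatedPenalty, Prod.fst_sub, Prod.snd_sub] at hle
  have hlocmax : IsLocalMax (fun z => separatedSum f g z - quadPoly p M z) x :=
    .of_forall fun z => by
      have := hle z
      simp only [separatedSum]
      linarith
  obtain ⟨⟨A₁, hA₁⟩, A₂, hA₂⟩ := differentiableAt_of_differentiableAt_coprod (hdiff hlocmax)
  have htouch := hle x
  refine ⟨A₁, A₂, hf.hasUpperJet hB hA₁ (by linarith), hg.hasUpperJet hD hA₂ (by linarith), ?_,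
    apply_add_apply_le_of_isLocalMax hf.hasFDerivAt hg.hasFDerivAt hA₁ hA₂ hlocmax⟩
  exact sub_eq_zero.1 <| hlocmax.hasFDerivAt_eq_zero <|
    (hasFDerivAt_separatedSum (hf.hasFDerivAt _) (hg.hasFDerivAt _)).sub
      (hasFDerivAt_quadPoly p M x)

theorem IsInterpolant.frequently_differentiableAt_coprod [FiniteDimensional ℝ E]
    [FiniteDimensional ℝ F] (hf : IsInterpolant B u C f f') (hg : IsInterpolant D v C g g')
    (M : E × F →L[ℝ] E × F →L[ℝ] ℝ) :
    ∃ᶠ p in 𝓝 0, ∀ x, IsLocalMax (fun z => separatedSum f g z - quadPoly p M z) x →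
      DifferentiableAt ℝ (fun z : E × F => (f' z.1).coprod (g' z.2)) x := by
  obtain ⟨c, hc⟩ := exists_lipschitzWith_coprod hf.lipschitzWith hg.lipschitzWith
  have hderiv : ∀ x, HasFDerivAt (fun z => separatedSum f g z - quadPoly 0 M z)
      ((f' x.1).coprod (g' x.2) - symmPart M x) x := fun x => by
    have h := (hasFDerivAt_separatedSum (hf.hasFDerivAt x.1) (hg.hasFDerivAt x.2)).sub
      (hasFDerivAt_quadPoly 0 M x)
    rwa [zero_add] at h
  refine (frequently_isLocalMax_sub_imp_differentiableAt hderiv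
    (hc.sub (symmPart M).lipschitz)).mono fun p hp x hx => ?_
  have hdiff := (hp x (by simpa [quadPoly, sub_sub, add_comm] using hx)).add
    (symmPart M).differentiableAt
  exact hdiff.congr_of_eventuallyEq (.of_forall fun z => (sub_add_cancel _ _).symm)

end SeparatedSum

section TheoremOnSums

set_option maxSynthPendingDepth 3

/-- The real inner product as a bilinear form: `innerSL ℝ` without the conjugation in its type. -/
def innerForm (E : Type*) [NormedAddCommGroup E] [InnerProductSpace ℝ E] : E →L[ℝ] E →L[ℝ] ℝ :=
  innerSL ℝ

theorem innerForm_apply {E : Type*} [NormedAddCommGroup E] [InnerProductSpace ℝ E] (x y : E) :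
    innerForm E x y = inner ℝ x y :=
  rfl

/-- The bilinear form on `E × F` with quadratic form `(h, k) ↦ ‖h‖² + ‖k‖²`. -/
def prodInner (E F : Type*) [NormedAddCommGroup E] [InnerProductSpace ℝ E]
    [NormedAddCommGroup F] [InnerProductSpace ℝ F] : E × F →L[ℝ] E × F →L[ℝ] ℝ :=
  (innerForm E).bilinearComp (.fst ℝ E F) (.fst ℝ E F) +
    (innerForm F).bilinearComp (.snd ℝ E F) (.snd ℝ E F)

theorem prodInner_apply_self {E F : Type*} [NormedAddCommGroup E] [InnerProductSpace ℝ E]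
    [NormedAddCommGroup F] [InnerProductSpace ℝ F] (z : E × F) :
    prodInner E F z z = ‖z.1‖ ^ 2 + ‖z.2‖ ^ 2 := by
  simp [prodInner, innerForm_apply]

variable {E F : Type*} [NormedAddCommGroup E] [InnerProductSpace ℝ E] [FiniteDimensional ℝ E]
  [NormedAddCommGroup F] [InnerProductSpace ℝ F] [FiniteDimensional ℝ F] {u : E → ℝ} {v : F → ℝ}
  {M : E × F →L[ℝ] E × F →L[ℝ] ℝ} {ρ η : ℝ}

theorem exists_hasUpperJet_of_strict_max (hρ : 0 < ρ)
    (hu : UpperSemicontinuousOn u (Metric.closedBall 0 ρ))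
    (hv : UpperSemicontinuousOn v (Metric.closedBall 0 ρ)) {ε : ℝ} (hε : 0 < ε)
    (hmax : ∀ z ∈ Metric.closedBall 0 ρ ×ˢ Metric.closedBall 0 ρ,
      separatedSum u v z ≤ separatedSum u v 0 + M z z / 2 - ε * ‖z‖ ^ 2) (hη : 0 < η) :
    ∃ z ∈ Metric.ball 0 η, ∃ p₁ p₂ A₁ A₂, HasUpperJet u z.1 p₁ A₁ ∧ HasUpperJet v z.2 p₂ A₂ ∧
      ‖p₁.coprod p₂‖ < η ∧ (∀ h k, A₁ h h + A₂ k k ≤ M (h, k) (h, k)) ∧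
      separatedSum u v 0 - η < separatedSum u v z := by
  obtain ⟨C, hC, hM, hdom⟩ := exists_strictlyDominates_separatedPenalty hε hmax
  have hE : (0 : E) ∈ Metric.closedBall 0 ρ := Metric.mem_closedBall_self hρ.le
  have hF : (0 : F) ∈ Metric.closedBall 0 ρ := Metric.mem_closedBall_self hρ.le
  obtain ⟨f, f', hf⟩ := exists_isInterpolant hC ⟨0, hE⟩
    (hu.bddAbove_of_isCompact (isCompact_closedBall 0 ρ))
  obtain ⟨g, g', hg⟩ := exists_isInterpolant hC ⟨0, hF⟩
    (hv.bddAbove_of_isCompact (isCompact_closedBall 0 ρ))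
  have hN : ∀ d, 0 ≤ separatedPenalty E F C d := fun d =>
    (by positivity : 0 ≤ C * ‖d‖ ^ 2).trans (mul_norm_sq_le_separatedPenalty hC d)
  obtain ⟨p, hdiff, hloc⟩ := ((hf.frequently_differentiableAt_coprod hg M).and_eventually
    (hdom.eventually_localized (by positivity) hN (lt_min hη hρ))).exists
  obtain ⟨⟨z, x⟩, hz, hzmax⟩ := hdom.exists_isMaxOn (p := p) (by positivity)
    ((isCompact_closedBall 0 ρ).prod (isCompact_closedBall 0 ρ)) ⟨hE, hF⟩
    (upperSemicontinuousOn_separatedSum hu hv) continuous_separatedPenalty separatedPenalty_zero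
  obtain ⟨hzlt, hgrad, hval⟩ := hloc z hz.1 x <| by
    simpa [doubledFunctional, separatedPenalty_zero, quadPoly_zero] using
      hzmax (show ((0, 0) : (E × F) × E × F) ∈ _ from ⟨⟨hE, hF⟩, mem_univ _⟩)
  rw [lt_min_iff] at hzlt hgrad
  have hzρ := max_lt_iff.1 (Prod.norm_def z ▸ hzlt.2)
  obtain ⟨A₁, A₂, hA₁, hA₂, hcoprod, hle⟩ := hf.exists_hasUpperJet hg hM
    (Metric.closedBall_mem_nhds_of_mem (mem_ball_zero_iff.2 hzρ.1))
    (Metric.closedBall_mem_nhds_of_mem (mem_ball_zero_iff.2 hzρ.2)) hzmax (hdiff x)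
  exact ⟨z, mem_ball_zero_iff.2 hzlt.1, _, _, A₁, A₂, hA₁, hA₂, hcoprod ▸ hgrad.1, hle,
    (sub_le_sub_left (min_le_left _ _) _).trans_lt hval⟩

theorem exists_hasUpperJet_of_separatedSum_zero (hρ : 0 < ρ)
    (hu : UpperSemicontinuousOn u (Metric.closedBall 0 ρ))
    (hv : UpperSemicontinuousOn v (Metric.closedBall 0 ρ))
    (h : HasUpperJet (separatedSum u v) 0 0 M) (hη : 0 < η) :
    ∃ z ∈ Metric.ball 0 η, ∃ p₁ p₂ A₁ A₂, HasUpperJet u z.1 p₁ A₁ ∧ HasUpperJet v z.2 p₂ A₂ ∧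
      ‖p₁.coprod p₂‖ < η ∧
      (∀ h k, A₁ h h + A₂ k k ≤ M (h, k) (h, k) + η * (‖h‖ ^ 2 + ‖k‖ ^ 2)) ∧
      separatedSum u v 0 - η < separatedSum u v z := by
  obtain ⟨r, hr, hball⟩ := Metric.nhds_basis_closedBall.eventually_iff.1
    (h (η / 4) (by positivity))
  have hmax : ∀ z ∈ Metric.closedBall 0 (min ρ r) ×ˢ Metric.closedBall 0 (min ρ r),
      separatedSum u v z ≤
        separatedSum u v 0 + (M + η • prodInner E F) z z / 2 - η / 4 * ‖z‖ ^ 2 := fun z hz => by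
    rw [closedBall_prod_same] at hz
    have hle := hball (Metric.closedBall_subset_closedBall (min_le_right ρ r) hz)
    have hnorm := mul_norm_sq_le_separatedPenalty hη.le z
    rw [zero_add, quadPoly, zero_apply, zero_add] at hle
    simp only [separatedPenalty, separatedSum.eq_1 fun x => η * ‖x‖ ^ 2] at hnorm
    simp only [add_apply, smul_apply, prodInner_apply_self, smul_eq_mul]
    linarith
  obtain ⟨z, hz, p₁, p₂, A₁, A₂, h₁, h₂, hp, hA, hval⟩ :=
    exists_hasUpperJet_of_strict_max (lt_min hρ hr)
      (hu.mono (Metric.closedBall_subset_closedBall (min_le_left ρ r)))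
      (hv.mono (Metric.closedBall_subset_closedBall (min_le_left ρ r))) (by positivity) hmax hη
  exact ⟨z, hz, p₁, p₂, A₁, A₂, h₁, h₂, hp,
    fun h k => by simpa [prodInner_apply_self] using hA h k, hval⟩

theorem exists_hasUpperJet_of_separatedSum {z₀ : E × F} {P : E × F →L[ℝ] ℝ} (hρ : 0 < ρ)
    (hu : UpperSemicontinuousOn u (Metric.closedBall z₀.1 ρ))
    (hv : UpperSemicontinuousOn v (Metric.closedBall z₀.2 ρ))
    (h : HasUpperJet (separatedSum u v) z₀ P M) (hη : 0 < η) :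
    ∃ z ∈ Metric.ball z₀ η, ∃ p₁ p₂ A₁ A₂, HasUpperJet u z.1 p₁ A₁ ∧ HasUpperJet v z.2 p₂ A₂ ∧
      ‖p₁.coprod p₂ - P‖ < η ∧
      (∀ h k, A₁ h h + A₂ k k ≤ M (h, k) (h, k) + η * (‖h‖ ^ 2 + ‖k‖ ^ 2)) ∧
      separatedSum u v z₀ - η < separatedSum u v z := by
  have hη' : 0 < η / (1 + ‖P‖) := by positivity
  have hη'P : η / (1 + ‖P‖) + ‖P‖ * (η / (1 + ‖P‖)) = η := by field_simp
  have hη'le : η / (1 + ‖P‖) ≤ η := div_le_self hη.le (by simp)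
  have hsum := separatedSum_comp_add_sub u v z₀ P
  obtain ⟨z, hz, p₁, p₂, A₁, A₂, h₁, h₂, hp, hA, hval⟩ :=
    exists_hasUpperJet_of_separatedSum_zero hρ
      (upperSemicontinuousOn_comp_add_sub hu (P.comp (.inl ℝ E F)))
      (upperSemicontinuousOn_comp_add_sub hv (P.comp (.inr ℝ E F)))
      (hsum ▸ hasUpperJet_sub_comp_add_iff.2 (by rwa [add_zero, zero_add])) hη'
  rw [mem_ball_zero_iff] at hz
  refine ⟨z₀ + z, by simpa using hz.trans_le hη'le, _, _, A₁, A₂, hasUpperJet_sub_comp_add_iff.1 h₁,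
    hasUpperJet_sub_comp_add_iff.1 h₂, ?_, fun h k => (hA h k).trans (by gcongr), ?_⟩
  · have hcoprod : (p₁ + P.comp (.inl ℝ E F)).coprod (p₂ + P.comp (.inr ℝ E F)) - P =
        p₁.coprod p₂ := by ext <;> simp
    exact hcoprod ▸ hp.trans_le hη'le
  · have hPz := (abs_le.1 (P.le_opNorm_of_le hz.le)).1
    simp only [hsum, map_zero, add_zero, sub_zero] at hval
    linarith

end TheoremOnSums

section Penalization

theorem eventually_forall_lt_of_penalty {X : Type*} [TopologicalSpace X] {K : Set X} {f g : X → ℝ}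
    {c : ℝ} (hK : IsCompact K) (hf : UpperSemicontinuousOn f K) (hg : LowerSemicontinuousOn g K)
    (hg0 : ∀ x ∈ K, 0 ≤ g x) (hlt : ∀ x ∈ K, g x = 0 → f x < c) :
    ∀ᶠ T in Filter.atTop, ∀ x ∈ K, f x - T * g x < c := by
  refine hK.induction_on (p := fun s => ∀ᶠ T in Filter.atTop, ∀ x ∈ s, f x - T * g x < c)
    (by simp) (fun s t hst ht => ht.mono fun T hT x hx => hT x (hst hx))
    (fun s t hs ht => by
      filter_upwards [hs, ht] with T hsT htT x hx using hx.elim (hsT x) (htT x)) fun x hx => ?_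
  rcases (hg0 x hx).eq_or_lt with hgx | hgx
  · refine ⟨_, (hf x hx c (hlt x hx hgx.symm)).and eventually_mem_nhdsWithin, ?_⟩
    filter_upwards [Filter.eventually_ge_atTop 0] with T hT y hy
    exact (sub_le_self _ (mul_nonneg hT (hg0 y hy.2))).trans_lt hy.1
  · refine ⟨_, (hf x hx (f x + 1) (lt_add_one _)).and (hg x hx (g x / 2) (half_lt_self hgx)), ?_⟩
    filter_upwards [Filter.eventually_ge_atTop 0,
      (Filter.tendsto_id.atTop_mul_const (half_pos hgx)).eventually_ge_atTop (f x + 1 - c)]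
      with T hT hTx y hy
    have := mul_le_mul_of_nonneg_left hy.2.le hT
    simp only [id_eq] at hTx
    linarith [hy.1]

theorem eventually_exists_isLocalMax_sub_penalty {X : Type*} [TopologicalSpace X] {K U : Set X}
    {f g : X → ℝ} {x₀ : X} (hK : IsCompact K) (hx₀ : K ∈ 𝓝 x₀) (hf : UpperSemicontinuousOn f K)
    (hg : Continuous g) (hg0 : ∀ x, 0 ≤ g x) (hgx₀ : g x₀ = 0)
    (hlt : ∀ x ∈ K, g x = 0 → x ≠ x₀ → f x < f x₀) (hU : U ∈ 𝓝 x₀) :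
    ∀ᶠ T in Filter.atTop, ∃ x ∈ U, IsLocalMax (fun y => f y - T * g y) x ∧
      f x₀ ≤ f x - T * g x := by
  have hKU : x₀ ∈ interior (K ∩ U) := mem_interior_iff_mem_nhds.2 (Filter.inter_mem hx₀ hU)
  have hfar := eventually_forall_lt_of_penalty (hK.diff isOpen_interior)
    (hf.mono sdiff_subset) (hg.lowerSemicontinuous.lowerSemicontinuousOn _) (fun x _ => hg0 x)
    fun x hx hgx => hlt x hx.1 hgx fun h => hx.2 (h ▸ hKU)
  filter_upwards [hfar] with T hT
  have husc : UpperSemicontinuousOn (fun y => f y - T * g y) K := by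
    have hcont : Continuous fun y => -(T * g y) := by fun_prop
    have hsum := hf.add (hcont.upperSemicontinuous.upperSemicontinuousOn K)
    exact hsum
  obtain ⟨x, hx, hmax⟩ := husc.exists_isMaxOn ⟨x₀, mem_of_mem_nhds hx₀⟩ hK
  have hle := hmax (mem_of_mem_nhds hx₀)
  simp only [mem_ofPred_eq, hgx₀, mul_zero, sub_zero] at hle
  have hxKU : x ∈ interior (K ∩ U) := by_contra fun h => hle.not_gt (hT x ⟨hx, h⟩)
  have hxK : K ∈ 𝓝 x := mem_interior_iff_mem_nhds.1 (interior_mono inter_subset_left hxKU)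
  exact ⟨x, (interior_subset hxKU).2, hmax.isLocalMax hxK, hle⟩

end Penalization

section DiagonalRestriction

set_option maxSynthPendingDepth 3

variable {E : Type*} [NormedAddCommGroup E] [InnerProductSpace ℝ E]

/-- The bilinear form on `E × E` with quadratic form `(x, y) ↦ A x x + 2 T ‖x - y‖²`, which for
large `T` penalizes leaving the diagonal. -/
def diagPenalty (A : E →L[ℝ] E →L[ℝ] ℝ) (T : ℝ) : E × E →L[ℝ] E × E →L[ℝ] ℝ :=
  A.bilinearComp (.fst ℝ E E) (.fst ℝ E E) + (2 * T) •
    (innerForm E).bilinearComp (ContinuousLinearMap.fst ℝ E E - ContinuousLinearMap.snd ℝ E E)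
      (ContinuousLinearMap.fst ℝ E E - ContinuousLinearMap.snd ℝ E E)

theorem diagPenalty_apply (A : E →L[ℝ] E →L[ℝ] ℝ) (T : ℝ) (z w : E × E) :
    diagPenalty A T z w = A z.1 w.1 + 2 * T * inner ℝ (z.1 - z.2) (w.1 - w.2) := by
  simp [diagPenalty, innerForm_apply, inner_sub_left]

theorem quadPoly_diagPenalty (p : E →L[ℝ] ℝ) (A : E →L[ℝ] E →L[ℝ] ℝ) (T : ℝ) (z : E × E) :
    quadPoly (p.comp (.fst ℝ E E)) (diagPenalty A T) z =
      quadPoly p A z.1 + T * ‖z.1 - z.2‖ ^ 2 := by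
  simp only [quadPoly, diagPenalty_apply, real_inner_self_eq_norm_sq,
    ContinuousLinearMap.comp_apply, ContinuousLinearMap.coe_fst']
  ring

theorem symmPart_diagPenalty_diag (A : E →L[ℝ] E →L[ℝ] ℝ) (T : ℝ) (z : E × E) (h : E) :
    symmPart (diagPenalty A T) z (h, h) = symmPart A z.1 h := by
  simp [symmPart_apply, diagPenalty_apply]

theorem norm_comp_diag_le {F : Type*} [SeminormedAddCommGroup F] [NormedSpace ℝ F]
    (P : F × F →L[ℝ] ℝ) :
    ‖P.comp ((ContinuousLinearMap.id ℝ F).prod (.id ℝ F))‖ ≤ ‖P‖ := by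
  refine P.comp _ |>.opNorm_le_bound (norm_nonneg P) fun h => ?_
  simpa using P.le_opNorm (h, h)

end DiagonalRestriction

section JetAddition

variable {E : Type*} [NormedAddCommGroup E] [InnerProductSpace ℝ E] {u v : E → ℝ}
  {x₀ : E} {p : E →L[ℝ] ℝ} {A : E →L[ℝ] E →L[ℝ] ℝ} {ρ η : ℝ}

theorem HasUpperJet.eventually_sub_quadPoly_lt (h : HasUpperJet u x₀ p A) (hη : 0 < η) :
    ∀ᶠ x in 𝓝 x₀, x ≠ x₀ → u x - quadPoly p (A + η • innerForm E) (x - x₀) < u x₀ := by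
  have hshift : Filter.Tendsto (fun x => x - x₀) (𝓝 x₀) (𝓝 0) :=
    Continuous.tendsto' (by fun_prop) _ _ (sub_self x₀)
  filter_upwards [hshift.eventually (h (η / 4) (by positivity))] with x hx hne
  have hpos : 0 < ‖x - x₀‖ := norm_pos_iff.2 (sub_ne_zero.2 hne)
  rw [add_sub_cancel] at hx
  simp only [quadPoly, add_apply, smul_apply, smul_eq_mul, innerForm_apply,
    real_inner_self_eq_norm_sq] at hx ⊢
  linarith [show 0 < η * ‖x - x₀‖ ^ 2 by positivity]

theorem eventually_exists_isLocalMax_sub_norm_sub_sq [FiniteDimensional ℝ E] {w : E × E → ℝ}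
    (hρ : 0 < ρ) (hw : UpperSemicontinuousOn w (Metric.closedBall (x₀, x₀) ρ))
    (hlt : ∀ᶠ x in 𝓝 x₀, x ≠ x₀ → w (x, x) < w (x₀, x₀)) {U : Set (E × E)}
    (hU : U ∈ 𝓝 (x₀, x₀)) :
    ∀ᶠ T in Filter.atTop, ∃ z ∈ U, IsLocalMax (fun z => w z - T * ‖z.1 - z.2‖ ^ 2) z ∧
      w (x₀, x₀) ≤ w z - T * ‖z.1 - z.2‖ ^ 2 := by
  obtain ⟨r, hr, hball⟩ := Metric.nhds_basis_closedBall.eventually_iff.1 hlt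
  refine eventually_exists_isLocalMax_sub_penalty (isCompact_closedBall (x₀, x₀) (min ρ r))
    (Metric.closedBall_mem_nhds _ (lt_min hρ hr))
    (hw.mono (Metric.closedBall_subset_closedBall (min_le_left ρ r)))
    (by fun_prop : Continuous fun z : E × E => ‖z.1 - z.2‖ ^ 2) (fun z => by positivity)
    (by simp) ?_ hU
  rintro ⟨x, y⟩ hz hxy hne
  obtain rfl : x = y := by simpa [sub_eq_zero] using hxy
  rw [← closedBall_prod_same] at hz
  exact hball (Metric.closedBall_subset_closedBall (min_le_right ρ r) hz.1) (by simpa using hne)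

theorem exists_hasUpperJet_separatedSum_of_add [FiniteDimensional ℝ E] (hρ : 0 < ρ)
    (hu : UpperSemicontinuousOn u (Metric.closedBall x₀ ρ))
    (hv : UpperSemicontinuousOn v (Metric.closedBall x₀ ρ))
    (h : HasUpperJet (fun x => u x + v x) x₀ p A) (hη : 0 < η) :
    ∃ z ∈ Metric.ball (x₀, x₀) η, ∃ P M, HasUpperJet (separatedSum u v) z P M ∧
      ‖P.comp ((ContinuousLinearMap.id ℝ E).prod (.id ℝ E)) - p‖ < η ∧
      (∀ h, M (h, h) (h, h) = A h h + η * ‖h‖ ^ 2) ∧ u x₀ + v x₀ - η < separatedSum u v z := by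
  set A' := A + η • innerForm E
  have hq : Continuous fun z : E × E => quadPoly p A' (z.1 - x₀) := by
    unfold quadPoly
    fun_prop
  have hsymm : Continuous fun z : E × E => ‖symmPart A' (z.1 - x₀)‖ := by fun_prop
  have hnear : ∀ᶠ z in 𝓝 (x₀, x₀), z ∈ Metric.ball (x₀, x₀) η ∧
      -η < quadPoly p A' (z.1 - x₀) ∧ ‖symmPart A' (z.1 - x₀)‖ < η :=
    .and (Metric.ball_mem_nhds _ hη) <|
      ((hq.tendsto _).eventually (lt_mem_nhds (by simpa [quadPoly_zero] using hη))).and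
        ((hsymm.tendsto _).eventually (gt_mem_nhds (by simpa using hη)))
  have husc : UpperSemicontinuousOn
      (fun z : E × E => separatedSum u v z - quadPoly p A' (z.1 - x₀))
      (Metric.closedBall (x₀, x₀) ρ) := by
    have hsum := (upperSemicontinuousOn_separatedSum hu hv).add
      (hq.neg.upperSemicontinuous.upperSemicontinuousOn _)
    rwa [closedBall_prod_same] at hsum
  have hdiag := h.eventually_sub_quadPoly_lt hη
  obtain ⟨T, ⟨z, ⟨hzη, hzq, hzs⟩, hmax, hle⟩, hT⟩ :=
    ((eventually_exists_isLocalMax_sub_norm_sub_sq hρ husc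
      (by simpa only [separatedSum, sub_self, quadPoly_zero, sub_zero] using hdiag) hnear).and
      (Filter.eventually_ge_atTop 0)).exists
  refine ⟨z, hzη, _, _, hasUpperJet_of_isLocalMax_sub_quadPoly (x := (x₀, x₀))
    (p := p.comp (.fst ℝ E E)) (A := diagPenalty A' T)
    (by simpa [quadPoly_diagPenalty, ← sub_sub] using hmax), ?_,
    fun h => by simp [diagPenalty_apply, A', innerForm_apply], ?_⟩
  · convert hzs
    ext h
    simp [symmPart_diagPenalty_diag]
  · rw [sub_self, quadPoly_zero, sub_zero, separatedSum] at hle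
    linarith [show 0 ≤ T * ‖z.1 - z.2‖ ^ 2 by positivity]

theorem exists_hasUpperJet_of_add [FiniteDimensional ℝ E] (hρ : 0 < ρ)
    (hu : UpperSemicontinuousOn u (Metric.closedBall x₀ ρ))
    (hv : UpperSemicontinuousOn v (Metric.closedBall x₀ ρ))
    (h : HasUpperJet (fun x => u x + v x) x₀ p A) (hη : 0 < η) :
    ∃ a ∈ Metric.ball x₀ η, ∃ b ∈ Metric.ball x₀ η, ∃ p₁ p₂ A₁ A₂,
      HasUpperJet u a p₁ A₁ ∧ HasUpperJet v b p₂ A₂ ∧ ‖p₁ + p₂ - p‖ < η ∧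
      (∀ h, A₁ h h + A₂ h h ≤ A h h + η * ‖h‖ ^ 2) ∧ u x₀ + v x₀ - η < u a + v b := by
  have hθ : 0 < min (η / 4) (ρ / 2) := by positivity
  set θ := min (η / 4) (ρ / 2)
  have hθη : θ ≤ η / 4 := min_le_left _ _
  have hθρ : θ ≤ ρ / 2 := min_le_right _ _
  obtain ⟨z₀, hz₀, P, M, hjet, hP, hM, hval⟩ :=
    exists_hasUpperJet_separatedSum_of_add hρ hu hv h hθ
  rw [← ball_prod_same] at hz₀
  have hsub : ∀ {y}, y ∈ Metric.ball x₀ θ → Metric.closedBall y (ρ / 2) ⊆ Metric.closedBall x₀ ρ :=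
    fun hy => Metric.closedBall_subset_closedBall' (by linarith [Metric.mem_ball.1 hy])
  obtain ⟨z, hz, p₁, p₂, A₁, A₂, h₁, h₂, hp, hA, hval'⟩ := exists_hasUpperJet_of_separatedSum
    (half_pos hρ) (hu.mono (hsub hz₀.1)) (hv.mono (hsub hz₀.2)) hjet hθ
  rw [← ball_prod_same] at hz
  have hball : ∀ {y y₀}, y ∈ Metric.ball y₀ θ → y₀ ∈ Metric.ball x₀ θ → y ∈ Metric.ball x₀ η :=
    fun {y y₀} hy hy₀ => by
      rw [Metric.mem_ball] at *
      linarith [dist_triangle y y₀ x₀]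
  refine ⟨z.1, hball hz.1 hz₀.1, z.2, hball hz.2 hz₀.2, p₁, p₂, A₁, A₂, h₁, h₂, ?_, fun h => ?_, ?_⟩
  · have hsplit : p₁ + p₂ - p =
        (p₁.coprod p₂ - P).comp ((ContinuousLinearMap.id ℝ E).prod (.id ℝ E)) +
          (P.comp ((ContinuousLinearMap.id ℝ E).prod (.id ℝ E)) - p) := by
      ext h
      simp
    rw [hsplit]
    linarith [norm_add_le_of_le (norm_comp_diag_le (p₁.coprod p₂ - P)) hP.le]
  · nlinarith [hA h h, hM h, sq_nonneg ‖h‖]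
  · rw [separatedSum.eq_1 u v z] at hval'
    linarith

theorem exists_hasUpperJet_of_add_abs_sub_lt [FiniteDimensional ℝ E] (hρ : 0 < ρ)
    (hu : UpperSemicontinuousOn u (Metric.closedBall x₀ ρ))
    (hv : UpperSemicontinuousOn v (Metric.closedBall x₀ ρ))
    (h : HasUpperJet (fun x => u x + v x) x₀ p A) (hη : 0 < η) :
    ∃ a ∈ Metric.ball x₀ ρ, ∃ b ∈ Metric.ball x₀ ρ, ∃ p₁ p₂ A₁ A₂,
      HasUpperJet u a p₁ A₁ ∧ HasUpperJet v b p₂ A₂ ∧ ‖p₁ + p₂ - p‖ < η ∧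
      (∀ h, A₁ h h + A₂ h h ≤ A h h + η * ‖h‖ ^ 2) ∧ |u a + v b - (u x₀ + v x₀)| < η := by
  have hx₀ := Metric.mem_closedBall_self (x := x₀) hρ.le
  have hnhds := nhdsWithin_eq_nhds.2 (Metric.closedBall_mem_nhds x₀ hρ)
  have hu₀ := hu x₀ hx₀ (u x₀ + η / 2) (by linarith)
  have hv₀ := hv x₀ hx₀ (v x₀ + η / 2) (by linarith)
  rw [hnhds] at hu₀ hv₀
  obtain ⟨r, hr, hball⟩ := Metric.eventually_nhds_iff_ball.1 (hu₀.and hv₀)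
  have hδ : 0 < min η (min r ρ) := lt_min hη (lt_min hr hρ)
  have hδη : min η (min r ρ) ≤ η := min_le_left _ _
  have hδr : min η (min r ρ) ≤ r := (min_le_right _ _).trans (min_le_left _ _)
  have hδρ : min η (min r ρ) ≤ ρ := (min_le_right _ _).trans (min_le_right _ _)
  obtain ⟨a, ha, b, hb, p₁, p₂, A₁, A₂, h₁, h₂, hp, hA, hval⟩ :=
    exists_hasUpperJet_of_add hρ hu hv h hδ
  have hua := (hball a (Metric.ball_subset_ball hδr ha)).1
  have hvb := (hball b (Metric.ball_subset_ball hδr hb)).2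
  exact ⟨a, Metric.ball_subset_ball hδρ ha, b, Metric.ball_subset_ball hδρ hb, p₁, p₂, A₁, A₂,
    h₁, h₂, hp.trans_le hδη, fun h => (hA h).trans (by gcongr),
    abs_lt.2 ⟨by linarith, by linarith⟩⟩

end JetAddition

section Truncation

variable {c c' s : ℝ} {z z' : EReal}

/-- Truncation of an extended real number from below at the level `c`, as a real number. It takes
the junk value `0` at `⊤`. -/
def truncBelow (c : ℝ) (z : EReal) : ℝ :=
  (max z c).toReal

theorem coe_truncBelow (hz : z ≠ ⊤) : (truncBelow c z : EReal) = max z c :=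
  EReal.coe_toReal (max_lt hz.lt_top (EReal.coe_lt_top c)).ne
    ((EReal.bot_lt_coe c).trans_le (le_max_right _ _)).ne'

theorem le_truncBelow (hz : z ≠ ⊤) : z ≤ truncBelow c z :=
  coe_truncBelow hz ▸ le_max_left _ _

theorem truncBelow_coe_of_le (h : c ≤ s) : truncBelow c s = s := by
  rw [truncBelow, max_eq_left (EReal.coe_le_coe_iff.2 h), EReal.toReal_coe]

theorem eq_coe_truncBelow_of_ne (hz : z ≠ ⊤) (h : truncBelow c z ≠ c) : z = truncBelow c z := by
  rw [coe_truncBelow hz]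
  refine (max_choice z (c : EReal)).elim Eq.symm fun hc => absurd ?_ h
  rw [truncBelow, hc, EReal.toReal_coe]

theorem truncBelow_add_truncBelow_le (hz : z ≠ ⊤) (hz' : z' ≠ ⊤) (h : z + z' ≤ s)
    (hc : truncBelow c z + c' ≤ s) (hc' : c + truncBelow c' z' ≤ s) :
    truncBelow c z + truncBelow c' z' ≤ s := by
  by_cases hzc : truncBelow c z = c
  · rwa [hzc]
  by_cases hzc' : truncBelow c' z' = c'
  · rwa [hzc']
  rwa [eq_coe_truncBelow_of_ne hz hzc, eq_coe_truncBelow_of_ne hz' hzc', ← EReal.coe_add,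
    EReal.coe_le_coe_iff] at h

theorem exists_coe_of_add_eq_coe (hz : z ≠ ⊤) (hz' : z' ≠ ⊤) (h : z + z' = s) :
    ∃ α β : ℝ, z = α ∧ z' = β ∧ α + β = s := by
  have hbot := h.trans_ne (EReal.coe_ne_bot s)
  rw [Ne, EReal.add_eq_bot_iff, not_or] at hbot
  lift z to ℝ using ⟨hz, hbot.1⟩
  lift z' to ℝ using ⟨hz', hbot.2⟩
  exact ⟨z, z', rfl, rfl, by rwa [← EReal.coe_add, EReal.coe_eq_coe_iff] at h⟩

theorem upperSemicontinuousOn_truncBelow {X : Type*} [TopologicalSpace X] {S : Set X}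
    {u : X → EReal} (hu : UpperSemicontinuousOn u S) (hS : ∀ x ∈ S, u x ≠ ⊤) :
    UpperSemicontinuousOn (fun x => truncBelow c (u x)) S := fun x hx y hy => by
  change truncBelow c (u x) < y at hy
  rw [← EReal.coe_lt_coe_iff, coe_truncBelow (hS x hx), max_lt_iff] at hy
  filter_upwards [hu x hx y hy.1, self_mem_nhdsWithin] with z hz hzS
  change truncBelow c (u z) < y
  rw [← EReal.coe_lt_coe_iff, coe_truncBelow (hS z hzS)]
  exact max_lt hz hy.2

end Truncation

section Jets

section ContDiff

variable {E : Type*} [NormedAddCommGroup E] [NormedSpace ℝ E] {u φ : E → ℝ} {x : E}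

theorem eventually_hasFDerivAt_fderiv (hφ : ContDiffAt ℝ 2 φ x) :
    ∀ᶠ y in 𝓝 x, HasFDerivAt φ (fderiv ℝ φ y) y :=
  (hφ.eventually (by simp)).mono fun _ hy => (hy.differentiableAt two_ne_zero).hasFDerivAt

theorem hasFDerivAt_fderiv (hφ : ContDiffAt ℝ 2 φ x) :
    HasFDerivAt (fderiv ℝ φ) (fderiv ℝ (fderiv ℝ φ) x) x :=
  ((hφ.fderiv_right (m := 1) (by norm_num)).differentiableAt one_ne_zero).hasFDerivAt

theorem hasUpperJet_of_le_contDiffAt (hφ : ContDiffAt ℝ 2 φ x) (hle : ∀ᶠ y in 𝓝 x, u y ≤ φ y)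
    (heq : u x = φ x) : HasUpperJet u x (fderiv ℝ φ x) (fderiv ℝ (fderiv ℝ φ) x) := by
  have hshift : Filter.Tendsto (fun h => x + h) (𝓝 0) (𝓝 x) :=
    (map_add_left_nhds_zero x).le
  refine hasUpperJet_of_hasFDerivAt (eventually_hasFDerivAt_fderiv hφ) (hasFDerivAt_fderiv hφ) ?_
  filter_upwards [hshift.eventually hle] with h hh
  rw [heq]
  exact sub_le_sub_right hh _

end ContDiff

theorem continuous_symmPart_apply {E : Type*} [NormedAddCommGroup E] [NormedSpace ℝ E] (h k : E) :
    Continuous fun A => symmPart A h k := by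
  simp only [symmPart_apply]
  fun_prop

variable {n : ℕ} {f : EuclideanSpace ℝ (Fin n) → ℝ}
  {f' : EuclideanSpace ℝ (Fin n) → EuclideanSpace ℝ (Fin n) →L[ℝ] ℝ}
  {p q : EuclideanSpace ℝ (Fin n) →L[ℝ] ℝ}
  {A B : EuclideanSpace ℝ (Fin n) →L[ℝ] EuclideanSpace ℝ (Fin n) →L[ℝ] ℝ}
  {x a : EuclideanSpace ℝ (Fin n)}

/-- The symmetric matrix of the symmetric part of a bilinear form on `ℝⁿ`. -/
def symMat (n : ℕ) :
    (EuclideanSpace ℝ (Fin n) →L[ℝ] EuclideanSpace ℝ (Fin n) →L[ℝ] ℝ) →ₗ[ℝ] SymMat n where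
  toFun A := ⟨Matrix.of fun i j =>
    symmPart A (EuclideanSpace.single i 1) (EuclideanSpace.single j 1), by
      ext i j
      simp [symmPart_apply, add_comm]⟩
  map_add' A B := by
    ext i j
    simp only [symmPart_apply, add_apply, Matrix.of_apply, AddSubgroup.coe_add, Matrix.add_apply]
    ring
  map_smul' c A := by
    ext i j
    simp [symmPart_apply]
    ring

theorem continuous_symMat : Continuous (symMat n) :=
  .subtype_mk (continuous_matrix fun _ _ => continuous_symmPart_apply _ _) _

/-- The `2`-jet with value `r` whose gradient represents the covector `p` and whose Hessian
represents the symmetric part of the bilinear form `A`. -/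
def Jet2.ofForm (r : ℝ) (p : EuclideanSpace ℝ (Fin n) →L[ℝ] ℝ)
    (A : EuclideanSpace ℝ (Fin n) →L[ℝ] EuclideanSpace ℝ (Fin n) →L[ℝ] ℝ) : Jet2 n :=
  (r, (InnerProductSpace.toDual ℝ _).symm p, symMat n A)

theorem Jet2.ofForm_add (r s : ℝ) :
    ofForm r p A + ofForm s q B = ofForm (r + s) (p + q) (A + B) := by
  simp only [ofForm, map_add, Prod.mk_add_mk]

theorem Jet2.tendsto_ofForm {ι : Type*} {l : Filter ι} {r : ι → ℝ}
    {P : ι → EuclideanSpace ℝ (Fin n) →L[ℝ] ℝ}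
    {M : ι → EuclideanSpace ℝ (Fin n) →L[ℝ] EuclideanSpace ℝ (Fin n) →L[ℝ] ℝ} {c : ℝ}
    (hr : Filter.Tendsto r l (𝓝 c)) (hP : Filter.Tendsto P l (𝓝 p))
    (hM : Filter.Tendsto M l (𝓝 A)) :
    Filter.Tendsto (fun i => ofForm (r i) (P i) (M i)) l (𝓝 (ofForm c p A)) :=
  hr.prodMk_nhds <| (((InnerProductSpace.toDual ℝ _).symm.continuous.tendsto p).comp hP).prodMk_nhds
    ((continuous_symMat.tendsto A).comp hM)

theorem jet2_eq_of_hasFDerivAt (hC : ContDiffAt ℝ 2 f x)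
    (hf : ∀ᶠ y in 𝓝 x, HasFDerivAt f (f' y) y) (hf' : HasFDerivAt f' A x) :
    jet2 f x hC = .ofForm (f x) (f' x) A := by
  have hfderiv : fderiv ℝ (fderiv ℝ f) x = A :=
    (hf'.congr_of_eventuallyEq (hf.mono fun y hy => hy.fderiv)).fderiv
  have hentries : hessian f x = symMat n A := by
    ext i j
    have hsymm := second_derivative_symmetric_of_eventually hf hf' (EuclideanSpace.single i 1)
      (EuclideanSpace.single j 1)
    simp only [hessian, hfderiv, Matrix.of_apply, symMat, LinearMap.coe_mk, AddHom.coe_mk,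
      symmPart_apply, ← hsymm, add_self_div_two]
  rw [jet2, gradient, hf.self_of_nhds.fderiv]
  exact congrArg (fun S => (f x, _, S)) (Subtype.ext hentries)

theorem symMat_symmPart : symMat n (symmPart A) = symMat n A := by
  ext i j
  simp only [symMat, LinearMap.coe_mk, AddHom.coe_mk, Matrix.of_apply, symmPart_apply]
  ring

theorem jet2_add_quadPoly (c : ℝ)
    (hC : ContDiffAt ℝ 2 (fun y => c + quadPoly p A (y - a)) a) :
    jet2 (fun y => c + quadPoly p A (y - a)) a hC = .ofForm c p A := by
  have hf (y : EuclideanSpace ℝ (Fin n)) : HasFDerivAt (fun y => c + quadPoly p A (y - a))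
      (p + symmPart A (y - a)) y :=
    ((hasFDerivAt_comp_sub a).2 (hasFDerivAt_quadPoly p A (y - a))).const_add c
  have hf' : HasFDerivAt (fun y => p + symmPart A (y - a)) (symmPart A) a :=
    ((hasFDerivAt_comp_sub a).2 (symmPart A).hasFDerivAt).const_add p
  rw [jet2_eq_of_hasFDerivAt hC (.of_forall hf) hf', Jet2.ofForm, symMat_symmPart, sub_self,
    quadPoly_zero, map_zero, add_zero, add_zero, Jet2.ofForm]

theorem IsSubharmonicAt.mem_of_hasUpperJet {F : Set (Jet2 n)} {w : EuclideanSpace ℝ (Fin n) → EReal}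
    {δ : ℝ} (hw : IsSubharmonicAt F w a) (hle : ∀ᶠ y in 𝓝 a, w y ≤ f y) (heq : w a = f a)
    (hf : HasUpperJet f a p A) (hδ : 0 < δ) (hAB : ∀ h, A h h + δ * ‖h‖ ^ 2 ≤ B h h) :
    .ofForm (f a) p B ∈ F := by
  have hC : ContDiffAt ℝ 2 (fun y => f a + quadPoly p B (y - a)) a :=
    (contDiff_const.add (contDiff_quadPoly.comp (contDiff_id.sub contDiff_const))).contDiffAt
  rw [← jet2_add_quadPoly (f a) hC]
  refine hw _ hC ?_ (by simpa [quadPoly_zero] using heq)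
  have hshift : Filter.Tendsto (fun y => y - a) (𝓝 a) (𝓝 0) :=
    Continuous.tendsto' (by fun_prop) _ _ (sub_self a)
  filter_upwards [hle, hshift.eventually (hf (δ / 2) (half_pos hδ))] with y hy hjet
  refine hy.trans (EReal.coe_le_coe_iff.2 ?_)
  rw [add_sub_cancel] at hjet
  simp only [quadPoly] at hjet ⊢
  linarith [hAB (y - a)]

end Jets

section SubharmonicAddition

variable {n : ℕ} {F G : Set (Jet2 n)} {X : Set (EuclideanSpace ℝ (Fin n))}
  {u v : EuclideanSpace ℝ (Fin n) → EReal} {φ : EuclideanSpace ℝ (Fin n) → ℝ}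
  {x₀ : EuclideanSpace ℝ (Fin n)}

theorem IsUSC.add (hu : IsUSC X u) (hv : IsUSC X v) : IsUSC X (u + v) :=
  ⟨hu.1.add' hv.1 fun x hx => EReal.continuousAt_add (.inl (hu.2 x hx)) (.inr (hv.2 x hx)),
    fun x hx => EReal.add_ne_top (hu.2 x hx) (hv.2 x hx)⟩

theorem IsUSC.exists_real_truncation (hX : IsOpen X) (hx₀ : x₀ ∈ X) (hu : IsUSC X u)
    (hv : IsUSC X v) (hφ : ContinuousAt φ x₀) (hle : ∀ᶠ y in 𝓝 x₀, (u + v) y ≤ φ y)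
    (heq : (u + v) x₀ = φ x₀) :
    ∃ (U V : EuclideanSpace ℝ (Fin n) → ℝ) (ρ : ℝ), 0 < ρ ∧ Metric.closedBall x₀ ρ ⊆ X ∧
      UpperSemicontinuousOn U X ∧ UpperSemicontinuousOn V X ∧
      (∀ x ∈ X, u x ≤ U x) ∧ (∀ x ∈ X, v x ≤ V x) ∧
      (∀ᶠ y in 𝓝 x₀, U y + V y ≤ φ y) ∧ U x₀ + V x₀ = φ x₀ ∧
      ∀ a ∈ Metric.closedBall x₀ ρ, ∀ b ∈ Metric.closedBall x₀ ρ, φ x₀ - 1 < U a + V b →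
        u a = U a ∧ v b = V b := by
  obtain ⟨α, β, hα, hβ, hαβ⟩ := exists_coe_of_add_eq_coe (hu.2 x₀ hx₀) (hv.2 x₀ hx₀) heq
  have hU := upperSemicontinuousOn_truncBelow (c := α - 2) hu.1 hu.2
  have hV := upperSemicontinuousOn_truncBelow (c := β - 2) hv.1 hv.2
  have hUα : truncBelow (α - 2) (u x₀) = α := by rw [hα, truncBelow_coe_of_le (by linarith)]
  have hVβ : truncBelow (β - 2) (v x₀) = β := by rw [hβ, truncBelow_coe_of_le (by linarith)]
  have hUlt := hU x₀ hx₀ (α + 1) (hUα.trans_lt (lt_add_one α))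
  have hVlt := hV x₀ hx₀ (β + 1) (hVβ.trans_lt (lt_add_one β))
  rw [hX.nhdsWithin_eq hx₀] at hUlt hVlt
  obtain ⟨ρ, hρ, hball⟩ := Metric.nhds_basis_closedBall.eventually_iff.1
    ((hX.eventually_mem hx₀).and (hUlt.and hVlt))
  refine ⟨_, _, ρ, hρ, fun x hx => (hball hx).1, hU, hV, fun x hx => le_truncBelow (hu.2 x hx),
    fun x hx => le_truncBelow (hv.2 x hx), ?_, by rw [hUα, hVβ, hαβ], fun a ha b hb hab => ?_⟩
  · have hφlt : ∀ᶠ y in 𝓝 x₀, φ x₀ - 1 < φ y := hφ.eventually (lt_mem_nhds (by linarith))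
    filter_upwards [hX.mem_nhds hx₀, hle, hUlt, hVlt, hφlt] with y hy hyle hyU hyV hyφ
    exact truncBelow_add_truncBelow_le (hu.2 y hy) (hv.2 y hy) hyle (by linarith) (by linarith)
  · obtain ⟨haX, haU, -⟩ := hball ha
    obtain ⟨hbX, -, hbV⟩ := hball hb
    exact ⟨eq_coe_truncBelow_of_ne (hu.2 a haX) fun h => by linarith,
      eq_coe_truncBelow_of_ne (hv.2 b hbX) fun h => by linarith⟩

theorem exists_ofForm_mem_add (hX : IsOpen X) (hu : u ∈ subharmonics F X)
    (hv : v ∈ subharmonics G X) (hx₀ : x₀ ∈ X) (hφ : ContDiffAt ℝ 2 φ x₀)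
    (hle : ∀ᶠ y in 𝓝 x₀, (u + v) y ≤ φ y) (heq : (u + v) x₀ = φ x₀) {η : ℝ} (hη : 0 < η) :
    ∃ r p, |r - φ x₀| < η ∧ ‖p - fderiv ℝ φ x₀‖ < η ∧
      .ofForm r p (fderiv ℝ (fderiv ℝ φ) x₀ + η • innerForm _) ∈ F + G := by
  obtain ⟨U, V, ρ, hρ, hρX, hU, hV, huU, hvV, hUVφ, hUV₀, hval⟩ :=
    hu.1.exists_real_truncation hX hx₀ hv.1 hφ.continuousAt hle heq
  have hη' : 0 < η / 3 := by positivity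
  obtain ⟨a, ha, b, hb, p₁, p₂, A₁, A₂, h₁, h₂, hp, hA, hr⟩ :=
    exists_hasUpperJet_of_add_abs_sub_lt hρ (hU.mono hρX) (hV.mono hρX)
      (hasUpperJet_of_le_contDiffAt hφ hUVφ hUV₀) (lt_min one_pos hη')
  rw [lt_min_iff] at hp hr
  rw [hUV₀] at hr
  replace ha := Metric.ball_subset_closedBall ha
  replace hb := Metric.ball_subset_closedBall hb
  obtain ⟨hua, hvb⟩ := hval a ha b hb (by linarith [(abs_lt.1 hr.1).1])
  have hF := (hu.2 a (hρX ha)).mem_of_hasUpperJet (B := A₁ + (η / 3) • innerForm _)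
    (Filter.eventually_of_mem (hX.mem_nhds (hρX ha)) huU) hua h₁ hη'
    fun h => by simp [innerForm_apply]
  have hG := (hv.2 b (hρX hb)).mem_of_hasUpperJet
    (B := fderiv ℝ (fderiv ℝ φ) x₀ + (2 * η / 3) • innerForm _ - A₁)
    (Filter.eventually_of_mem (hX.mem_nhds (hρX hb)) hvV) hvb h₂ hη' fun h => by
      have hmin : min 1 (η / 3) * ‖h‖ ^ 2 ≤ η / 3 * ‖h‖ ^ 2 := by gcongr; exact min_le_right _ _
      simp only [add_apply, sub_apply, smul_apply, innerForm_apply, real_inner_self_eq_norm_sq,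
        smul_eq_mul]
      linarith [hA h]
  refine ⟨U a + V b, p₁ + p₂, by linarith, by linarith, ?_⟩
  have hsum : fderiv ℝ (fderiv ℝ φ) x₀ + η • innerForm _ = A₁ + (η / 3) • innerForm _ +
      (fderiv ℝ (fderiv ℝ φ) x₀ + (2 * η / 3) • innerForm _ - A₁) := by module
  rw [hsum, ← Jet2.ofForm_add]
  exact add_mem_add hF hG

set_option maxSynthPendingDepth 3 in
theorem isSubharmonicAt_closure_add (hX : IsOpen X) (hu : u ∈ subharmonics F X)
    (hv : v ∈ subharmonics G X) (hx₀ : x₀ ∈ X) :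
    IsSubharmonicAt (closure (F + G)) (u + v) x₀ := fun φ hφ hle heq => by
  have hpos (k : ℕ) : (0 : ℝ) < 1 / (k + 1) := Nat.one_div_pos_of_nat
  choose r p hr hp hmem using fun k => exists_ofForm_mem_add hX hu hv hx₀ hφ hle heq (hpos k)
  have hlim := tendsto_one_div_add_atTop_nhds_zero_nat (𝕜 := ℝ)
  have hr₀ : Filter.Tendsto r Filter.atTop (𝓝 (φ x₀)) := tendsto_iff_dist_tendsto_zero.2 <|
    squeeze_zero (fun _ => dist_nonneg) (fun k => (hr k).le) hlim
  have hp₀ : Filter.Tendsto p Filter.atTop (𝓝 (fderiv ℝ φ x₀)) :=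
    tendsto_iff_norm_sub_tendsto_zero.2 <|
      squeeze_zero (fun _ => norm_nonneg _) (fun k => (hp k).le) hlim
  have hA₀ : Filter.Tendsto (fun k : ℕ => fderiv ℝ (fderiv ℝ φ) x₀ +
      (1 / ((k : ℝ) + 1)) • innerForm (EuclideanSpace ℝ (Fin n))) Filter.atTop
      (𝓝 (fderiv ℝ (fderiv ℝ φ) x₀)) := by
    simpa using (hlim.smul_const (innerForm (EuclideanSpace ℝ (Fin n)))).const_add
      (fderiv ℝ (fderiv ℝ φ) x₀)
  rw [jet2_eq_of_hasFDerivAt hφ (eventually_hasFDerivAt_fderiv hφ) (hasFDerivAt_fderiv hφ)]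
  exact mem_closure_of_tendsto (Jet2.tendsto_ofForm hr₀ hp₀ hA₀) (.of_forall hmem)

end SubharmonicAddition

end PotentialTheory

end

theorem mainTheorem7_general {n : ℕ} (F G H : Set (PotentialTheory.Jet2 n)) (hH : IsClosed H)
    (hFG : F + G ⊆ H) (X : Set (EuclideanSpace ℝ (Fin n))) (hX : IsOpen X) :
    PotentialTheory.subharmonics F X + PotentialTheory.subharmonics G X ⊆
      PotentialTheory.subharmonics H X := by
  rintro _ ⟨u, hu, v, hv, rfl⟩
  exact ⟨hu.1.add hv.1, fun x₀ hx₀ φ hφ hle heq => closure_minimal hFG hH <|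
    PotentialTheory.isSubharmonicAt_closure_add hX hu hv hx₀ φ hφ hle heq⟩

theorem mainTheorem7 {n : ℕ} (F G H : Set (PotentialTheory.Jet2 n))
    (hF : PotentialTheory.IsConstCoeffSubequation F)
    (hG : PotentialTheory.IsConstCoeffSubequation G)
    (hH : IsClosed H) (hFG : F + G ⊆ H)
    (X : Set (EuclideanSpace ℝ (Fin n))) (hX : IsOpen X) :
    PotentialTheory.subharmonics F X + PotentialTheory.subharmonics G X ⊆
      PotentialTheory.subharmonics H X :=
  mainTheorem7_general F G H hH hFG X hX
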